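/- **Setting.** Let $\mathcal H^0$ be a complex Hilbert space and $H$ a self-adjoint operator in $\mathcal H^0$ with $H\ge c$ for some $c>0$. For $k\ge 0$ let $\mathcal H^k=D(H^{k/2})$ with the norm $\|\psi\|_k=\|H^{k/2}\psi\|_0$, and write $\langle x\rangle=(1+x^2)^{1/2}$. Let $\mathcal L(X,Y)$ denote the bounded linear maps $X\to Y$, $\mathcal L(X)=\mathcal L(X,X)$, and $C_b(\mathbb R,\mathcal B)$ the bounded norm-continuous maps $\mathbb R\to\mathcal B$. Let $L(t)$, $t\in\mathbb R$, be linear operators $\mathcal H^{2m}\to\mathcal H^0$. Let $\tau<1$ be real and assume: * (H0) $m\ge 0$ and $k_0>2m$ are integers and $L(\cdot)\in C_b(\mathbb R,\mathcal L(\mathcal H^{k+2m},\mathcal H^k))$ for all real $0\le k\le k_0$. * (H1) For every $t$, $\langle L(t)\psi,\varphi\rangle_0=\langle\psi,L(t)\varphi\rangle_0$ for all $\psi,\varphi\in\mathcal H^{k_0+2m}$. For a real $k_1$, consider the condition * (H3) $k_1>2m$ and $[L(\cdot),H]H^{-\tau}\in C_b(\mathbb R,\mathcal L(\mathcal H^k))$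 for all real $0\le k\le 2k_1$. A *propagator* is a family $U(t,s)$, $t,s\in\mathbb R$, of bounded operators on $\mathcal H^0$ such that for all $s$ and all $\psi_s\in\mathcal H^{2m}$ the function $\psi(t)=U(t,s)\psi_s$ belongs to $C(\mathbb R,\mathcal H^{2m})\cap C^1(\mathbb R,\mathcal H^0)$ and solves $i\partial_t\psi(t)=L(t)\psi(t)$, $\psi(s)=\psi_s$. **Theorem.** Assume (H0) and (H1). (i) Assume that (H3) holds for some real $k_1$. Then there is exactly one propagator $U$. Let $k$ be real with $0\le k\le\min\{k_0,2k_1\}-4m$ and $k\le k_1$, and let $p\in\mathbb N$ (possibly $0$) satisfy $\frac{k}{1-\tau}\le p$. Then $U(t,s)$ maps $\mathcal H^{2k}$ into itself for all $t,s\in\mathbb R$, and there is a constant $C>0$, independent of $t$, $s$ and $\psi_s$, such that $$\|U(t,s)\psi_s\|_{2k}\le C\,\langle t-s\rangle^{p}\,\|\psi_s\|_{2k}\qquad\text{for all }t,s\in\mathbb R,\ \psi_s\in\mathcal H^{2k}.$$ (ii) Assume that $[L(\cdot),H]H^{-\tau}\in C_b(\mathbb R,\mathcal L(\mathcal H^k))$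 for every $k\in\mathbb N$ and that $\tau$ is rational. Then there is exactly one propagator $U$, and for every real $r>0$ the operators $U(t,s)$ map $\mathcal H^r$ into itself and there is a constant $C_r>0$, independent of $t$, $s$ and $\psi_s$, such that $$\|U(t,s)\psi_s\|_{r}\le C_r\,\langle t-s\rangle^{\frac{r}{2(1-\tau)}}\,\|\psi_s\|_{r}\qquad\text{for all }t,s\in\mathbb R,\ \psi_s\in\mathcal H^{r}.$$ -/

import Mathlib

open scoped NNReal InnerProductSpace BoundedContinuousFunction

/-- A positive self-adjoint operator `H` on the complex Hilbert space `E`: an unbounded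
(`LinearPMap`) self-adjoint operator (its domain is dense by `IsSelfAdjoint.dense_domain`) with
`⟪Hx, x⟫ ≥ c ‖x‖²` for some `c > 0`, so that all negative powers of `H` are bounded and
`‖H^{k/2} ·‖` is a complete norm on `D(H^{k/2})`. -/
structure PositiveOperator (E : Type*) [NormedAddCommGroup E] [InnerProductSpace ℂ E]
    [CompleteSpace E] where
  toPMap : E →ₗ.[ℂ] E
  isSelfAdjoint : IsSelfAdjoint toPMap
  bddBelow : ∃ c : ℝ, 0 < c ∧ ∀ x : toPMap.domain,
    c * ‖(x : E)‖ ^ 2 ≤ (⟪toPMap x, (x : E)⟫_ℂ).re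

/-- The Japanese bracket `⟨x⟩ = (1 + x²)^{1/2}`. -/
noncomputable def japaneseBracket (x : ℝ) : ℝ := Real.sqrt (1 + x ^ 2)

namespace PositiveOperator

variable {E : Type*} [NormedAddCommGroup E] [InnerProductSpace ℂ E] [CompleteSpace E]
  (H : PositiveOperator E)

theorem inner_symm (x y : H.toPMap.domain) :
    ⟪H.toPMap x, (y : E)⟫_ℂ = ⟪(x : E), H.toPMap y⟫_ℂ := by
  have hd := H.isSelfAdjoint.dense_domain
  have h := LinearPMap.adjoint_isFormalAdjoint hd
  rw [LinearPMap.isSelfAdjoint_def.mp H.isSelfAdjoint] at h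
  exact h x y

theorem exists_norm_bound : ∃ c : ℝ, 0 < c ∧ ∀ x : H.toPMap.domain,
    c * ‖(x : E)‖ ≤ ‖H.toPMap x‖ := by
  obtain ⟨c, hc, h⟩ := H.bddBelow
  refine ⟨c, hc, fun x => ?_⟩
  have h1 := h x
  have h2 : (⟪H.toPMap x, (x : E)⟫_ℂ).re ≤ ‖H.toPMap x‖ * ‖(x : E)‖ :=
    re_inner_le_norm (𝕜 := ℂ) _ _
  rcases (norm_nonneg (x : E)).eq_or_lt with h0 | h0
  · rw [← h0]; simp
  · nlinarith

theorem surjective : Function.Surjective H.toPMap := by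
  have hd := H.isSelfAdjoint.dense_domain
  obtain ⟨c, hc, hb⟩ := H.exists_norm_bound
  have hclosed : IsClosed ((LinearMap.range H.toPMap.toFun : Submodule ℂ E) : Set E) := by
    rw [← isSeqClosed_iff_isClosed]
    intro u y hu huy
    choose x hx using hu
    have hcau : CauchySeq (fun n => (x n : E)) := by
      rw [Metric.cauchySeq_iff']
      intro ε hε
      obtain ⟨N, hN⟩ := Metric.cauchySeq_iff'.mp huy.cauchySeq (c * ε) (by positivity)
      refine ⟨N, fun n hn => ?_⟩
      have h1 := hN n hn
      have h2 := hb (x n - x N)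
      rw [dist_eq_norm, ← hx n, ← hx N, ← map_sub] at h1
      rw [dist_eq_norm]
      have h3 : c * ‖(x n : E) - x N‖ < c * ε := lt_of_le_of_lt (by simpa using h2) h1
      exact lt_of_mul_lt_mul_left h3 hc.le
    obtain ⟨z, hz⟩ := cauchySeq_tendsto_of_complete hcau
    have hgr : IsClosed (H.toPMap.graph : Set (E × E)) := H.isSelfAdjoint.isClosed
    have hmem : (z, y) ∈ H.toPMap.graph := by
      refine hgr.mem_of_tendsto (hz.prodMk_nhds huy) (Filter.Eventually.of_forall fun n => ?_)
      have h4 := H.toPMap.mem_graph (x n)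
      have h5 : H.toPMap (x n) = u n := hx n
      rw [h5] at h4
      exact h4
    rw [LinearPMap.mem_graph_iff] at hmem
    obtain ⟨w, _, hw⟩ := hmem
    exact ⟨w, hw⟩
  have hperp : (LinearMap.range H.toPMap.toFun : Submodule ℂ E)ᗮ = ⊥ := by
    rw [Submodule.eq_bot_iff]
    intro y hy
    have hy' : ∀ x : H.toPMap.domain, ⟪(0 : E), (x : E)⟫_ℂ = ⟪y, H.toPMap x⟫_ℂ := by
      intro x
      rw [inner_zero_left]
      exact ((Submodule.mem_orthogonal' _ _).mp hy _ ⟨x, rfl⟩).symm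
    have hdom : y ∈ H.toPMap.adjoint.domain := LinearPMap.mem_adjoint_domain_of_exists _ ⟨0, hy'⟩
    have hval : H.toPMap.adjoint ⟨y, hdom⟩ = 0 := LinearPMap.adjoint_apply_eq hd _ hy'
    have hgr : (y, (0 : E)) ∈ H.toPMap.adjoint.graph := by
      have := H.toPMap.adjoint.mem_graph ⟨y, hdom⟩
      rwa [hval] at this
    rw [LinearPMap.isSelfAdjoint_def.mp H.isSelfAdjoint, LinearPMap.mem_graph_iff] at hgr
    obtain ⟨w, hw, hw0⟩ := hgr
    have h1 := hb w
    rw [hw0, norm_zero] at h1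
    have hw' : (w : E) = y := hw
    rw [hw'] at h1
    have h2 : ‖y‖ ≤ 0 := by nlinarith [norm_nonneg y]
    exact norm_le_zero_iff.mp h2
  have : CompleteSpace (LinearMap.range H.toPMap.toFun : Submodule ℂ E) :=
    hclosed.completeSpace_coe
  intro y
  have htop := (Submodule.orthogonal_eq_bot_iff).mp hperp
  have hy : y ∈ (LinearMap.range H.toPMap.toFun : Submodule ℂ E) := by rw [htop]; trivial
  exact hy

/-- A self-adjoint operator bounded below by `c > 0` has a bounded everywhere defined inverse. -/
theorem exists_inv : ∃ A : E →L[ℂ] E, (∀ x : H.toPMap.domain, A (H.toPMap x) = x) ∧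
    ∀ y : E, ∃ h : A y ∈ H.toPMap.domain, H.toPMap ⟨A y, h⟩ = y := by
  obtain ⟨c, hc, hb⟩ := H.exists_norm_bound
  have hinj : Function.Injective H.toPMap.toFun := by
    rw [← LinearMap.ker_eq_bot, LinearMap.ker_eq_bot']
    intro x hx
    have h1 := hb x
    have h0 : H.toPMap x = 0 := hx
    rw [h0, norm_zero] at h1
    have h2 : ‖(x : E)‖ ≤ 0 := by nlinarith [norm_nonneg (x : E)]
    exact Subtype.ext (norm_le_zero_iff.mp h2)
  let e := LinearEquiv.ofBijective H.toPMap.toFun ⟨hinj, H.surjective⟩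
  have he : ∀ y, H.toPMap (e.symm y) = y := fun y => e.apply_symm_apply y
  refine ⟨(H.toPMap.domain.subtype ∘ₗ e.symm.toLinearMap).mkContinuous c⁻¹ fun y => ?_,
    fun x => ?_, fun y => ⟨(e.symm y).2, he y⟩⟩
  · have h1 := hb (e.symm y)
    rw [he] at h1
    rw [inv_mul_eq_div, le_div_iff₀ hc, mul_comm]
    exact h1
  · exact congrArg Subtype.val (e.symm_apply_apply x)

/-- The bounded inverse `H⁻¹`. -/
noncomputable def inv : E →L[ℂ] E := H.exists_inv.choose

theorem inv_apply (x : H.toPMap.domain) : H.inv (H.toPMap x) = x :=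
  H.exists_inv.choose_spec.1 x

theorem inv_mem (y : E) : H.inv y ∈ H.toPMap.domain := (H.exists_inv.choose_spec.2 y).choose

theorem apply_inv (y : E) : H.toPMap ⟨H.inv y, H.inv_mem y⟩ = y :=
  (H.exists_inv.choose_spec.2 y).choose_spec

theorem inv_injective : Function.Injective H.inv := by
  intro x y h
  rw [← H.apply_inv x, ← H.apply_inv y]
  congr 1
  exact Subtype.ext h

theorem inv_nonneg : 0 ≤ H.inv := by
  rw [ContinuousLinearMap.nonneg_iff_isPositive, ContinuousLinearMap.isPositive_iff]
  constructor
  · intro x y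
    have h := H.inner_symm ⟨H.inv x, H.inv_mem x⟩ ⟨H.inv y, H.inv_mem y⟩
    rw [H.apply_inv, H.apply_inv] at h
    exact h.symm
  · intro x
    obtain ⟨c, hc, h⟩ := H.bddBelow
    have h1 := h ⟨H.inv x, H.inv_mem x⟩
    have h2 := H.inner_symm ⟨H.inv x, H.inv_mem x⟩ ⟨H.inv x, H.inv_mem x⟩
    rw [H.apply_inv] at h1 h2
    have h3 : ⟪H.inv x, x⟫_ℂ = (starRingEnd ℂ) ⟪H.inv x, x⟫_ℂ := by
      rw [inner_conj_symm]; exact h2.symm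
    rw [RCLike.nonneg_iff]
    refine ⟨?_, ?_⟩
    · have h4 : (⟪H.inv x, x⟫_ℂ).re = (⟪x, H.inv x⟫_ℂ).re := by rw [h2]
      have : 0 ≤ (⟪x, H.inv x⟫_ℂ).re := le_trans (by positivity) h1
      simpa [h4] using this
    · exact RCLike.conj_eq_iff_im.mp h3.symm

/-- The bounded operator `H^{-s} = (H⁻¹)^s`, `s ≥ 0`, by the continuous functional calculus of the
positive bounded operator `H⁻¹`. -/
noncomputable def negPow (s : ℝ≥0) : E →L[ℂ] E := H.inv ^ (s : ℝ)

theorem negPow_zero : H.negPow 0 = 1 := by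
  unfold negPow
  exact CFC.rpow_zero _ H.inv_nonneg

theorem negPow_one : H.negPow 1 = H.inv := by
  unfold negPow
  exact CFC.rpow_one _ H.inv_nonneg

theorem negPow_add (s t : ℝ≥0) : H.negPow (s + t) = H.negPow s * H.negPow t := by
  unfold negPow
  rw [CFC.rpow_def, CFC.rpow_def, CFC.rpow_def]
  refine Eq.trans ?_ (cfc_mul (R := ℝ≥0) (fun x => x ^ (s : ℝ)) (fun x => x ^ (t : ℝ)) H.inv
    (NNReal.continuous_rpow_const s.2).continuousOn
    (NNReal.continuous_rpow_const t.2).continuousOn)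
  refine cfc_congr fun x _ => ?_
  simp only [NNReal.coe_add]
  exact NNReal.rpow_add_of_nonneg x s.2 t.2

theorem negPow_injective (s : ℝ≥0) : Function.Injective (H.negPow s) := by
  have hnat : ∀ n : ℕ, Function.Injective (H.negPow n) := by
    intro n
    induction n with
    | zero => rw [Nat.cast_zero, negPow_zero]; exact fun _ _ h => h
    | succ n ih =>
      rw [Nat.cast_succ, negPow_add, negPow_one]
      exact ih.comp H.inv_injective
  obtain ⟨n, hn⟩ := exists_nat_ge s
  have h : H.negPow n = H.negPow (n - s) * H.negPow s := by
    rw [← negPow_add, tsub_add_cancel_of_le hn]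
  have h2 := hnat n
  rw [h] at h2
  exact Function.Injective.of_comp h2

/-- The operator `H^s` for real `s`: for `s ≥ 0` its domain is the range of `H^{-s}` and it is the
inverse of `H^{-s}` there; for `s ≤ 0` it is the bounded operator `H^{-|s|}` on all of `E`. -/
noncomputable def rpow (s : ℝ) : E →ₗ.[ℂ] E where
  domain := LinearMap.range (H.negPow s.toNNReal).toLinearMap
  toFun := (H.negPow (-s).toNNReal).toLinearMap ∘ₗ
    (LinearEquiv.ofInjective (H.negPow s.toNNReal).toLinearMap
      (H.negPow_injective s.toNNReal)).symm.toLinearMap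

theorem rpow_injective (s : ℝ) : Function.Injective (H.rpow s).toFun :=
  (H.negPow_injective _).comp (LinearEquiv.injective _)

/-- The power `H^1` of the functional calculus is `H` itself. -/
theorem rpow_one : H.rpow 1 = H.toPMap := by
  have key : ∀ x : E, ∀ h : H.negPow (1 : ℝ).toNNReal x ∈ (H.rpow 1).domain,
      H.rpow 1 ⟨H.negPow (1 : ℝ).toNNReal x, h⟩ = x := by
    intro x h
    change H.negPow (-1 : ℝ).toNNReal ((LinearEquiv.ofInjective
      (H.negPow (1 : ℝ).toNNReal).toLinearMap (H.negPow_injective _)).symm ⟨_, h⟩) = x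
    have h0 : (-1 : ℝ).toNNReal = 0 := Real.toNNReal_of_nonpos (by norm_num)
    rw [h0, negPow_zero]
    exact LinearEquiv.symm_apply_apply (LinearEquiv.ofInjective
      (H.negPow (1 : ℝ).toNNReal).toLinearMap (H.negPow_injective _)) x
  have hA : H.negPow (1 : ℝ).toNNReal = H.inv := by rw [Real.toNNReal_one, negPow_one]
  refine LinearPMap.ext ?_ ?_
  · ext x
    constructor
    · rintro ⟨y, rfl⟩
      change H.negPow (1 : ℝ).toNNReal y ∈ _
      rw [hA]
      exact H.inv_mem y
    · intro hx
      refine ⟨H.toPMap ⟨x, hx⟩, ?_⟩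
      change H.negPow (1 : ℝ).toNNReal _ = _
      rw [hA, H.inv_apply]
  · intro x hx hx'
    obtain ⟨y, rfl⟩ := id hx
    change H.rpow 1 ⟨H.negPow (1 : ℝ).toNNReal y, hx⟩ =
      H.toPMap ⟨H.negPow (1 : ℝ).toNNReal y, hx'⟩
    rw [key y hx]
    have : (⟨H.negPow (1 : ℝ).toNNReal y, hx'⟩ : H.toPMap.domain) = ⟨H.inv y, H.inv_mem y⟩ :=
      Subtype.ext (congrArg (fun T : E →L[ℂ] E => T y) hA)
    rw [this, H.apply_inv]

theorem rpow_domain_mono {s t : ℝ} (h : s ≤ t) : (H.rpow t).domain ≤ (H.rpow s).domain := by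
  rintro _ ⟨y, rfl⟩
  have hle : s.toNNReal ≤ t.toNNReal := Real.toNNReal_le_toNNReal h
  refine ⟨H.negPow (t.toNNReal - s.toNNReal) y, ?_⟩
  change (H.negPow _ * H.negPow _) y = H.negPow _ y
  rw [← negPow_add, add_tsub_cancel_of_le hle]

/-- The space `𝓗^k = D(H^{k/2})`, `k ≥ 0`, of the scale generated by `H`. -/
def Sob (k : ℝ≥0) : Type _ := (H.rpow ((k : ℝ) / 2)).domain

namespace Sob

variable {H} {k : ℝ≥0}

noncomputable instance : AddCommGroup (H.Sob k) := inferInstanceAs (AddCommGroup (H.rpow ((k : ℝ) / 2)).domain)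

noncomputable instance : Module ℂ (H.Sob k) := inferInstanceAs (Module ℂ (H.rpow ((k : ℝ) / 2)).domain)

instance : CoeOut (H.Sob k) E := ⟨fun ψ => Subtype.val ψ⟩

/-- The norm of `𝓗^k` is `‖ψ‖_k = ‖H^{k/2} ψ‖`. -/
noncomputable instance : NormedAddCommGroup (H.Sob k) :=
  NormedAddCommGroup.induced (H.Sob k) E (H.rpow ((k : ℝ) / 2)).toFun (H.rpow_injective _)

noncomputable instance : NormedSpace ℂ (H.Sob k) :=
  NormedSpace.induced ℂ (H.Sob k) E (H.rpow ((k : ℝ) / 2)).toFun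

theorem norm_def (ψ : H.Sob k) : ‖ψ‖ = ‖H.rpow ((k : ℝ) / 2) ψ‖ := rfl

/-- The inclusion `𝓗^b ⊆ 𝓗^a` for `a ≤ b`. -/
noncomputable def incl {a b : ℝ≥0} (h : a ≤ b) (ψ : H.Sob b) : H.Sob a :=
  ⟨(ψ : E), H.rpow_domain_mono (by have : (a : ℝ) ≤ b := h; linarith) ψ.2⟩

theorem mem_rpow_domain {τ : ℝ} (hτ : τ ≤ 1) (ψ : H.Sob (k + 2)) :
    (ψ : E) ∈ (H.rpow τ).domain :=
  H.rpow_domain_mono (by push_cast; linarith [k.2]) ψ.2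

theorem mem_domain (ψ : H.Sob (k + 2)) : (ψ : E) ∈ H.toPMap.domain := by
  rw [← H.rpow_one]
  exact mem_rpow_domain le_rfl ψ

theorem apply_mem (ψ : H.Sob (k + 2)) :
    H.toPMap ⟨(ψ : E), mem_domain ψ⟩ ∈ (H.rpow ((k : ℝ) / 2)).domain := by
  obtain ⟨y, hy⟩ := ψ.2
  have h1 : (((k + 2 : ℝ≥0) : ℝ) / 2).toNNReal = 1 + ((k : ℝ) / 2).toNNReal := by
    have : ((k + 2 : ℝ≥0) : ℝ) / 2 = 1 + (k : ℝ) / 2 := by push_cast; ring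
    rw [this, Real.toNNReal_add zero_le_one (by positivity), Real.toNNReal_one]
  rw [h1, negPow_add, negPow_one] at hy
  have hy' : H.inv (H.negPow ((k : ℝ) / 2).toNNReal y) = (ψ : E) := hy
  refine ⟨y, ?_⟩
  have h2 : (⟨(ψ : E), mem_domain ψ⟩ : H.toPMap.domain) =
      ⟨H.inv (H.negPow ((k : ℝ) / 2).toNNReal y), H.inv_mem _⟩ := Subtype.ext hy'.symm
  rw [h2, H.apply_inv]
  rfl

end Sob

/-- `H` as a map `𝓗^{k+2} → 𝓗^k`. -/
noncomputable def act {k : ℝ≥0} (ψ : H.Sob (k + 2)) : H.Sob k :=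
  ⟨H.toPMap ⟨(ψ : E), Sob.mem_domain ψ⟩, Sob.apply_mem ψ⟩

/-- The time dependent operator `T` on `𝓗^a` belongs to `C_b(ℝ, 𝓛(𝓗^a, 𝓗^b))`. -/
def MemCb {a b : ℝ≥0} (T : ℝ → H.Sob a → E) : Prop :=
  ∃ F : ℝ →ᵇ (H.Sob a →L[ℂ] H.Sob b), ∀ (t : ℝ) (ψ : H.Sob a), ((F t ψ : H.Sob b) : E) = T t ψ

/-- `t ↦ L(t)` belongs to `C_b(ℝ, 𝓛(𝓗^{k+2m}, 𝓗^k))` for all real `0 ≤ k ≤ k₀`. -/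
def BoundedOnScale (m k₀ : ℕ) (L : ℝ → H.Sob (2 * m) →ₗ[ℂ] E) : Prop :=
  ∀ k : ℝ≥0, k ≤ k₀ →
    H.MemCb (a := k + 2 * m) (b := k) fun t ψ => L t (Sob.incl le_add_self ψ)

/-- Every `L(t)` is symmetric on `𝓗^{k₀+2m}` for the scalar product of `𝓗^0`. -/
def SymmetricOnScale (m k₀ : ℕ) (L : ℝ → H.Sob (2 * m) →ₗ[ℂ] E) : Prop :=
  ∀ (t : ℝ) (ψ φ : H.Sob (k₀ + 2 * m)),
    ⟪L t (Sob.incl le_add_self ψ), (φ : E)⟫_ℂ = ⟪(ψ : E), L t (Sob.incl le_add_self φ)⟫_ℂ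

/-- `B(t)` is (the everywhere defined extension of) the operator `[L(t), H] H^{-τ}`: the identity
`[L(t), H] ψ = B(t) H^τ ψ` holds for `ψ ∈ 𝓗^{2m+2}`, where the commutator `L(t)H - HL(t)` is
understood in the sense of forms, against `φ ∈ 𝓗^2 = D(H)`. -/
def IsCommutator (m : ℕ) (L : ℝ → H.Sob (2 * m) →ₗ[ℂ] E) {τ : ℝ} (hτ : τ < 1)
    (B : ℝ → E →ₗ[ℂ] E) : Prop :=
  ∀ (t : ℝ) (φ : H.toPMap.domain) (ψ : H.Sob (2 * m + 2)),
    ⟪(φ : E), L t (H.act ψ)⟫_ℂ - ⟪H.toPMap φ, L t (Sob.incl le_self_add ψ)⟫_ℂ =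
      ⟪(φ : E), B t (H.rpow τ ⟨(ψ : E), Sob.mem_rpow_domain hτ.le ψ⟩)⟫_ℂ

/-- `[L(·), H] H^{-τ}` belongs to `C_b(ℝ, 𝓛(𝓗^k))` for every `k` in the set `I` (with `0 ∈ I`). -/
def CommutatorBoundedOn (m : ℕ) (L : ℝ → H.Sob (2 * m) →ₗ[ℂ] E) {τ : ℝ} (hτ : τ < 1)
    (I : Set ℝ≥0) : Prop :=
  ∃ B : ℝ → E →ₗ[ℂ] E, H.IsCommutator m L hτ B ∧
    ∀ k ∈ I, H.MemCb (a := k) (b := k) fun t ψ => B t (ψ : E)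

/-- `U` is the propagator of `i ∂_t ψ = L(t) ψ`: the `U(t,s)` are bounded operators on `𝓗^0`, and
for every initial time `s` and datum `ψ_s ∈ 𝓗^{2m}` the function `ψ(t) = U(t,s) ψ_s` is in
`C(ℝ, 𝓗^{2m}) ∩ C^1(ℝ, 𝓗^0)`, solves the equation and satisfies `ψ(s) = ψ_s`. -/
def IsPropagator (m : ℕ) (L : ℝ → H.Sob (2 * m) →ₗ[ℂ] E) (U : ℝ → ℝ → E →L[ℂ] E) : Prop :=
  ∀ (s : ℝ) (ψs : H.Sob (2 * m)), ∃ ψ : ℝ → H.Sob (2 * m),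
    (∀ t, (ψ t : E) = U t s (ψs : E)) ∧ ψ s = ψs ∧ Continuous ψ ∧
    ContDiff ℝ 1 (fun t => (ψ t : E)) ∧
    ∀ t, Complex.I • deriv (fun r => (ψ r : E)) t = L t (ψ t)

/-- `‖U ψ‖_k ≤ M ‖ψ‖_k` for all `ψ ∈ 𝓗^k` (in particular `U` maps `𝓗^k` into itself). -/
def NormBound (k : ℝ≥0) (U : E →L[ℂ] E) (M : ℝ) : Prop :=
  ∀ ψ : H.Sob k, ∃ χ : H.Sob k, (χ : E) = U (ψ : E) ∧ ‖χ‖ ≤ M * ‖ψ‖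

end PositiveOperator

/-! ### Linear differential equations with bounded coefficients. -/

section LinearODE

variable {F : Type*} [NormedAddCommGroup F] [NormedSpace ℝ F]

/-! Put `δ = 1 - τ`. The problem is encoded by bounded operators: `Λ = L H^{-m}` and `B`, with `[L,
H] = B H^{1-δ}` multiplied by enough powers of `H⁻¹` to make sense on all of `E` (`IsBoundedModel`).

Replace `L` by `R L R`, where `R` is a function of `H` mapping into the domain of `H^N` and tending
strongly to `1` as `ε → 0`. This generator is bounded and self-adjoint, so its flow is unitary.
Conjugated by `H^K` it becomes `R L R - R S R H^{-δ}`, with `S` bounded uniformly in `t` and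
independent of `ε`, because the operators `H^i B H^{-i}`, `i < K`, are bounded (`exists_regGen_eq`).
So the conjugated flow `v` solves a Schrödinger equation up to an error of size `‖H^{-δ} v‖`, while
`‖H^{-K} v‖` is conserved. If `θ K ≤ δ` and `θ ≤ 1`, interpolation bounds the error by a multiple of
`‖v‖^{1-θ} ‖H^{-K} v‖^θ`. Hence `‖v‖^θ` grows at most linearly, and `‖v‖` at most like `⟨t-s⟩^{1/θ}`
(`rpow_norm_le_of_hasDerivAt`, `exists_norm_evolution_le`).

With `K = m + 1` these uniform bounds and Duhamel's formula make the regularized flows Cauchy as `ε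
→ 0`; their limit is a propagator (`exists_isModelFlow`). Uniqueness is conservation of the norm
(`IsPropagator.eq`). Heinz' inequality interpolates between unitarity on `𝓗^0` and the bound on
`𝓗^{2K}`: on `𝓗^{2ηK}` the growth exponent is `η/θ` (`exists_normBound`). The choice `θ = δ/K`, `η =
k/K` gives `k/δ`. -/

theorem abs_sinh_le_cosh (x : ℝ) : |Real.sinh x| ≤ Real.cosh x := by
  rw [Real.abs_sinh, ← Real.cosh_abs]
  exact (Real.sinh_lt_cosh _).le

/-- The weight `cosh (c (t - s))` is a smooth two-sided substitute for `exp (c |t - s|)`.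
Integrating it gains a factor `1 / c`, since `|sinh| ≤ cosh`. -/
theorem norm_integral_apply_cosh_smul_le {G : ℝ → F →L[ℝ] F} {C c : ℝ} (hC : 0 ≤ C) (hc : 0 < c)
    (hGC : ∀ t, ‖G t‖ ≤ C) (s t : ℝ) {u : ℝ → F} {D : ℝ} (hD : 0 ≤ D) (hu : ∀ t, ‖u t‖ ≤ D) :
    ‖∫ r in s..t, G r (Real.cosh (c * (r - s)) • u r)‖ ≤
      C * D / c * Real.cosh (c * (t - s)) := by
  have hint : ∫ r in s..t, C * D * Real.cosh (c * (r - s)) =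
      C * D / c * Real.sinh (c * (t - s)) := by
    have hderiv : ∀ r ∈ Set.uIcc s t, HasDerivAt (fun r => C * D / c * Real.sinh (c * (r - s)))
        (C * D * Real.cosh (c * (r - s))) r := by
      intro r _
      have h1 : HasDerivAt (fun r => c * (r - s)) (c * 1) r :=
        ((hasDerivAt_id r).sub_const s).const_mul c
      have h2 := (h1.sinh).const_mul (C * D / c)
      refine h2.congr_deriv ?_
      field_simp
    rw [intervalIntegral.integral_eq_sub_of_hasDerivAt hderiv
      (Continuous.intervalIntegrable (by fun_prop) _ _)]
    simp
  have hle : ‖∫ r in s..t, G r (Real.cosh (c * (r - s)) • u r)‖ ≤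
      |∫ r in s..t, C * D * Real.cosh (c * (r - s))| := by
    refine intervalIntegral.norm_integral_le_abs_of_norm_le ?_
      (Continuous.intervalIntegrable (by fun_prop) _ _)
    refine Filter.Eventually.of_forall fun r => ?_
    have hp := Real.cosh_pos (c * (r - s))
    calc ‖G r (Real.cosh (c * (r - s)) • u r)‖
        ≤ ‖G r‖ * ‖Real.cosh (c * (r - s)) • u r‖ := (G r).le_opNorm _
      _ = ‖G r‖ * (Real.cosh (c * (r - s)) * ‖u r‖) := by
          rw [norm_smul, Real.norm_of_nonneg hp.le]
      _ ≤ C * (Real.cosh (c * (r - s)) * D) := by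
          gcongr
          · exact hGC r
          · exact hu r
      _ = _ := by ring
  refine hle.trans ?_
  rw [hint, abs_mul, abs_of_nonneg (by positivity)]
  gcongr
  exact abs_sinh_le_cosh _

/-- Global existence for a linear differential equation with bounded continuous coefficients. -/
theorem exists_hasDerivAt_linear [CompleteSpace F] {G : ℝ → F →L[ℝ] F} (hG : Continuous G)
    {C : ℝ} (hGC : ∀ t, ‖G t‖ ≤ C) (s : ℝ) (x : F) :
    ∃ v : ℝ → F, v s = x ∧ ∀ t, HasDerivAt v (G t (v t)) t := by
  have hC : 0 ≤ C := (norm_nonneg _).trans (hGC s)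
  -- Chosen so that `C / c ≤ 1/2`: the weighted integral operator is then a contraction on all of
  -- `ℝ` at once.
  set c : ℝ := 2 * C + 1 with hc_def
  have hc : 0 < c := by positivity
  have hCc : C / c ≤ 1 / 2 := by rw [div_le_iff₀ hc]; linarith
  let w : ℝ → ℝ := fun t => Real.cosh (c * (t - s))
  have hw : ∀ t, 0 < w t := fun t => Real.cosh_pos _
  have hw1 : ∀ t, 1 ≤ w t := fun t => Real.one_le_cosh _
  have hwc : Continuous w := by fun_prop
  have hcont : ∀ u : ℝ → F, Continuous u → Continuous fun r => G r (w r • u r) :=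
    fun u hu => hG.clm_apply (hwc.smul hu)
  have hprim : ∀ u : ℝ → F, Continuous u → Continuous fun t => ∫ r in s..t, G r (w r • u r) :=
    fun u hu => intervalIntegral.continuous_primitive
      (fun a b => (hcont u hu).intervalIntegrable a b) s
  have hest : ∀ (u : ℝ → F) (D : ℝ), 0 ≤ D → (∀ t, ‖u t‖ ≤ D) → ∀ t,
      ‖(w t)⁻¹ • ∫ r in s..t, G r (w r • u r)‖ ≤ 1 / 2 * D := by
    intro u D hD hu t
    rw [norm_smul, norm_inv, Real.norm_of_nonneg (hw t).le, inv_mul_le_iff₀ (hw t)]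
    refine (norm_integral_apply_cosh_smul_le hC hc hGC s t hD hu).trans ?_
    have h1 : C * D / c = C / c * D := by ring
    rw [h1, mul_comm (w t)]
    gcongr
  -- The unknown is `u = v / w`, which stays bounded although the solution `v` may grow
  -- exponentially.
  let Φ : (ℝ →ᵇ F) → (ℝ →ᵇ F) := fun u => BoundedContinuousFunction.ofNormedAddCommGroup
    (fun t => (w t)⁻¹ • (x + ∫ r in s..t, G r (w r • u r)))
    ((hwc.inv₀ fun t => (hw t).ne').smul (continuous_const.add (hprim u u.continuous)))
    (‖x‖ + 1 / 2 * ‖u‖) fun t => by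
      rw [smul_add]
      refine (norm_add_le _ _).trans (add_le_add ?_ (hest u ‖u‖ (norm_nonneg _) u.norm_coe_le_norm t))
      rw [norm_smul, norm_inv, Real.norm_of_nonneg (hw t).le]
      exact mul_le_of_le_one_left (norm_nonneg _) (inv_le_one_of_one_le₀ (hw1 t))
  have hΦ : ∀ u t, Φ u t = (w t)⁻¹ • (x + ∫ r in s..t, G r (w r • u r)) := fun _ _ => rfl
  have hcontr : ContractingWith (1 / 2 : ℝ≥0) Φ := by
    refine ⟨by rw [← NNReal.coe_lt_coe]; norm_num, LipschitzWith.of_dist_le_mul fun u v => ?_⟩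
    rw [BoundedContinuousFunction.dist_le (by positivity)]
    intro t
    have h1 : Φ u t - Φ v t = (w t)⁻¹ • ∫ r in s..t, G r (w r • (u - v) r) := by
      rw [hΦ, hΦ, ← smul_sub, add_sub_add_left_eq_sub, ← intervalIntegral.integral_sub
        ((hcont u u.continuous).intervalIntegrable _ _)
        ((hcont v v.continuous).intervalIntegrable _ _)]
      congr 1
      refine intervalIntegral.integral_congr fun r _ => ?_
      simp only [BoundedContinuousFunction.coe_sub, Pi.sub_apply, smul_sub, map_sub]
    rw [dist_eq_norm, h1, dist_eq_norm]
    simpa using hest (u - v) ‖u - v‖ (norm_nonneg _) (u - v).norm_coe_le_norm t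
  have hfix := hcontr.fixedPoint_isFixedPt
  set u := hcontr.fixedPoint
  have hv : ∀ t, w t • u t = x + ∫ r in s..t, G r (w r • u r) := by
    intro t
    have h1 : u t = (w t)⁻¹ • (x + ∫ r in s..t, G r (w r • u r)) := by
      rw [← hΦ, hfix.eq]
    conv_lhs => rw [h1]
    rw [smul_inv_smul₀ (hw t).ne']
  refine ⟨fun t => w t • u t, ?_, fun t => ?_⟩
  · simp [hv s]
  · have h1 := intervalIntegral.integral_hasDerivAt_right
      ((hcont u u.continuous).intervalIntegrable s t)
      ((hcont u u.continuous).stronglyMeasurableAtFilter _ _)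
      (hcont u u.continuous).continuousAt
    have h2 := h1.const_add x
    exact h2.congr_of_eventuallyEq (Filter.Eventually.of_forall hv)

theorem eq_of_hasDerivAt_linear {G : ℝ → F →L[ℝ] F} {C : ℝ} (hGC : ∀ t, ‖G t‖ ≤ C) {v w : ℝ → F}
    (hv : ∀ t, HasDerivAt v (G t (v t)) t) (hw : ∀ t, HasDerivAt w (G t (w t)) t) {s : ℝ}
    (h : v s = w s) : v = w := by
  have hC : 0 ≤ C := (norm_nonneg _).trans (hGC s)
  refine ODE_solution_unique_univ (v := fun t x => G t x) (s := fun _ => Set.univ)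
    (K := C.toNNReal) (t₀ := s) (fun t => ?_) (fun t => ⟨hv t, trivial⟩)
    (fun t => ⟨hw t, trivial⟩) h
  refine ((G t).lipschitz.weaken ?_).lipschitzOnWith
  rw [← NNReal.coe_le_coe, Real.coe_toNNReal _ hC]
  exact hGC t

end LinearODE

/-! ### Evolution families of bounded generators. -/

section Evolution

variable {E : Type*} [NormedAddCommGroup E] [NormedSpace ℂ E]

/-- Left multiplication by `-i G`, as a real linear operator on `𝓛(E)`. -/
noncomputable def leftGenerator (G : E →L[ℂ] E) : (E →L[ℂ] E) →L[ℝ] (E →L[ℂ] E) :=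
  ContinuousLinearMap.mul ℝ (E →L[ℂ] E) (-Complex.I • G)

theorem norm_leftGenerator_le (G : E →L[ℂ] E) : ‖leftGenerator G‖ ≤ ‖G‖ := by
  refine (ContinuousLinearMap.opNorm_mul_apply_le ℝ _ _).trans ?_
  simp [norm_smul]

theorem continuous_leftGenerator {G : ℝ → E →L[ℂ] E} (hG : Continuous G) :
    Continuous fun t => leftGenerator (G t) :=
  (ContinuousLinearMap.continuous _).comp (hG.const_smul (-Complex.I))

/-- Bounded norm continuous families of operators. -/
def IsBddCont (G : ℝ → E →L[ℂ] E) : Prop := Continuous G ∧ ∃ C, ∀ t, ‖G t‖ ≤ C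

theorem IsBddCont.exists_evolution [CompleteSpace E] {G : ℝ → E →L[ℂ] E} (hG : IsBddCont G)
    (s : ℝ) : ∃ V : ℝ → E →L[ℂ] E, V s = 1 ∧ ∀ t, HasDerivAt V ((-Complex.I • G t) * V t) t := by
  obtain ⟨hc, C, hC⟩ := hG
  exact exists_hasDerivAt_linear (continuous_leftGenerator hc)
    (fun t => (norm_leftGenerator_le _).trans (hC t)) s 1

theorem IsBddCont.eq_of_hasDerivAt {G : ℝ → E →L[ℂ] E} (hG : IsBddCont G)
    {V W : ℝ → E →L[ℂ] E} (hV : ∀ t, HasDerivAt V ((-Complex.I • G t) * V t) t)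
    (hW : ∀ t, HasDerivAt W ((-Complex.I • G t) * W t) t) {s : ℝ} (h : V s = W s) : V = W := by
  obtain ⟨hc, C, hC⟩ := hG
  exact eq_of_hasDerivAt_linear (G := fun t => leftGenerator (G t))
    (fun t => (norm_leftGenerator_le _).trans (hC t)) hV hW h

open Classical in
/-- The evolution family of `i V' = G(t) V` for a bounded norm continuous family `G`. -/
noncomputable def evolution [CompleteSpace E] (G : ℝ → E →L[ℂ] E) (t s : ℝ) : E →L[ℂ] E :=
  -- The value `1` outside `IsBddCont` is a mere default; the lemmas on `evolution` all assume
  -- `IsBddCont`.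
  if hG : IsBddCont G then (hG.exists_evolution s).choose t else 1

namespace IsBddCont

variable [CompleteSpace E] {G : ℝ → E →L[ℂ] E}

theorem evolution_self (hG : IsBddCont G) (s : ℝ) : evolution G s s = 1 := by
  unfold evolution
  rw [dif_pos hG]
  exact (hG.exists_evolution s).choose_spec.1

theorem hasDerivAt_evolution (hG : IsBddCont G) (t s : ℝ) :
    HasDerivAt (fun t => evolution G t s) ((-Complex.I • G t) * evolution G t s) t := by
  unfold evolution
  simp only [dif_pos hG]
  exact (hG.exists_evolution s).choose_spec.2 t

theorem evolution_mul (hG : IsBddCont G) (t s r : ℝ) :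
    evolution G t s * evolution G s r = evolution G t r := by
  have h := hG.eq_of_hasDerivAt (V := fun t => evolution G t s * evolution G s r)
    (W := fun t => evolution G t r) (s := s)
    (fun t => by
      have := (hG.hasDerivAt_evolution t s).mul_const (evolution G s r)
      simpa only [mul_assoc] using this)
    (fun t => hG.hasDerivAt_evolution t r) (by simp [hG.evolution_self])
  exact congrFun h t

/-- Intertwining generators have intertwining evolution families. -/
theorem evolution_intertwine (hG : IsBddCont G) {G' : ℝ → E →L[ℂ] E} (hG' : IsBddCont G')
    {X : E →L[ℂ] E} (h : ∀ t, X * G' t = G t * X) (t s : ℝ) :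
    X * evolution G' t s = evolution G t s * X := by
  have h := hG.eq_of_hasDerivAt (V := fun t => X * evolution G' t s)
    (W := fun t => evolution G t s * X) (s := s)
    (fun t => by
      have := (hG'.hasDerivAt_evolution t s).const_mul X
      refine this.congr_deriv ?_
      rw [← mul_assoc, ← mul_assoc, smul_mul_assoc, mul_smul_comm, h])
    (fun t => by
      have := (hG.hasDerivAt_evolution t s).mul_const X
      simpa only [mul_assoc] using this) (by simp [hG.evolution_self, hG'.evolution_self])
  exact congrFun h t

theorem hasDerivAt_evolution_apply (hG : IsBddCont G) (t s : ℝ) (x : E) :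
    HasDerivAt (fun t => evolution G t s x) (-Complex.I • G t (evolution G t s x)) t := by
  have h := (ContinuousLinearMap.apply ℂ E x).restrictScalars ℝ |>.hasFDerivAt
    (x := evolution G t s) |>.comp_hasDerivAt t (hG.hasDerivAt_evolution t s)
  exact h

end IsBddCont

end Evolution

/-! ### Unitarity and Duhamel's formula for self-adjoint generators. -/

section Unitary

variable {E : Type*} [NormedAddCommGroup E] [InnerProductSpace ℂ E] [CompleteSpace E]
  {G : ℝ → E →L[ℂ] E}

namespace IsBddCont

/-- The contributions `i G` and `-i G` cancel in the derivative of `V* V`. -/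
theorem star_evolution_mul_self (hG : IsBddCont G) (hs : ∀ t, IsSelfAdjoint (G t)) (t s : ℝ) :
    star (evolution G t s) * evolution G t s = 1 := by
  have hd : ∀ t, HasDerivAt (fun t => star (evolution G t s) * evolution G t s) 0 t := by
    intro t
    have h1 := hG.hasDerivAt_evolution t s
    have h2 := h1.star.mul h1
    refine h2.congr_deriv ?_
    rw [star_mul, star_smul, (hs t).star_eq]
    simp [mul_assoc]
  have h := is_const_of_deriv_eq_zero (fun t => (hd t).differentiableAt)
    (fun t => (hd t).deriv) t s
  rw [h, hG.evolution_self]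
  simp

theorem star_evolution (hG : IsBddCont G) (hs : ∀ t, IsSelfAdjoint (G t)) (t s : ℝ) :
    star (evolution G t s) = evolution G s t := by
  have h1 := hG.star_evolution_mul_self hs t s
  have h2 : evolution G t s * evolution G s t = 1 := by
    rw [hG.evolution_mul, hG.evolution_self]
  calc star (evolution G t s) = star (evolution G t s) * (evolution G t s * evolution G s t) := by
        rw [h2, mul_one]
    _ = _ := by rw [← mul_assoc, h1, one_mul]

theorem norm_evolution_apply (hG : IsBddCont G) (hs : ∀ t, IsSelfAdjoint (G t)) (t s : ℝ) (x : E) :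
    ‖evolution G t s x‖ = ‖x‖ := by
  have h1 := hG.star_evolution_mul_self hs t s
  have h2 : ⟪evolution G t s x, evolution G t s x⟫_ℂ = ⟪x, x⟫_ℂ := by
    rw [← ContinuousLinearMap.adjoint_inner_right]
    have : (ContinuousLinearMap.adjoint (evolution G t s)) (evolution G t s x) = x :=
      congrArg (fun T : E →L[ℂ] E => T x) h1
    rw [this]
  rw [inner_self_eq_norm_sq_to_K, inner_self_eq_norm_sq_to_K] at h2
  have h3 : ‖evolution G t s x‖ ^ 2 = ‖x‖ ^ 2 := by exact_mod_cast h2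
  exact (sq_eq_sq₀ (norm_nonneg _) (norm_nonneg _)).mp h3

/-- Duhamel's bound for an approximate solution of a Schrödinger equation. -/
theorem norm_sub_evolution_le (hG : IsBddCont G) (hs : ∀ t, IsSelfAdjoint (G t))
    {φ g : ℝ → E} (hφ : ∀ t, HasDerivAt φ (-Complex.I • G t (φ t) + g t) t) {η : ℝ} {s t : ℝ}
    (hη : ∀ r ∈ Set.uIcc s t, ‖g r‖ ≤ η) :
    ‖φ t - evolution G t s (φ s)‖ ≤ η * |t - s| := by
  have hd : ∀ r, HasDerivAt (fun r => evolution G s r (φ r)) (evolution G s r (g r)) r := by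
    intro r
    -- The derivative in the second time variable comes from the one in the first by taking
    -- adjoints.
    have h1 : HasDerivAt (fun r => evolution G s r) (evolution G s r * (Complex.I • G r)) r := by
      have h := (hG.hasDerivAt_evolution r s).star
      simp only [hG.star_evolution hs] at h
      refine h.congr_deriv ?_
      rw [star_mul, star_smul, (hs r).star_eq, hG.star_evolution hs]
      simp
    have h2 := (ContinuousLinearMap.restrictScalarsL ℂ E E ℝ ℝ).hasFDerivAt
      (x := evolution G s r) |>.comp_hasDerivAt r h1
    refine (HasDerivAt.clm_apply h2 (hφ r)).congr_deriv ?_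
    simp
  have h := Convex.norm_image_sub_le_of_norm_hasDerivWithin_le (f := fun r => evolution G s r (φ r))
    (f' := fun r => evolution G s r (g r)) (C := η) (s := Set.uIcc s t)
    (fun r _ => (hd r).hasDerivWithinAt)
    (fun r hr => by rw [hG.norm_evolution_apply hs]; exact hη r hr) (convex_uIcc s t)
    Set.left_mem_uIcc Set.right_mem_uIcc
  have h2 : φ t - evolution G t s (φ s) =
      evolution G t s (evolution G s t (φ t) - evolution G s s (φ s)) := by
    rw [map_sub, ← mul_apply_eq_comp, ← mul_apply_eq_comp,
      hG.evolution_mul, hG.evolution_mul, hG.evolution_self]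
    simp
  rw [h2, hG.norm_evolution_apply hs]
  simpa using h

end IsBddCont

end Unitary

/-! ### Operator inequalities and fractional powers. -/

section Loewner

variable {E : Type*} [NormedAddCommGroup E] [InnerProductSpace ℂ E] [CompleteSpace E]

theorem inner_apply_of_isSelfAdjoint {T : E →L[ℂ] E} (hT : IsSelfAdjoint T) (x y : E) :
    ⟪T x, y⟫_ℂ = ⟪x, T y⟫_ℂ := by
  conv_lhs => rw [← ContinuousLinearMap.isSelfAdjoint_iff'.mp hT]
  exact ContinuousLinearMap.adjoint_inner_left T y x

theorem re_inner_le_of_le {E : Type*} [NormedAddCommGroup E] [InnerProductSpace ℂ E]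
    {S T : E →L[ℂ] E} (h : S ≤ T) (x : E) :
    (⟪S x, x⟫_ℂ).re ≤ (⟪T x, x⟫_ℂ).re := by
  have h1 := ((ContinuousLinearMap.le_def S T).mp h).re_inner_nonneg_left x
  simp only [sub_apply, inner_sub_left] at h1
  have h2 : 0 ≤ (⟪T x, x⟫_ℂ - ⟪S x, x⟫_ℂ).re := h1
  rw [Complex.sub_re] at h2
  linarith

theorem le_of_re_inner_le {S T : E →L[ℂ] E} (hS : IsSelfAdjoint S) (hT : IsSelfAdjoint T)
    (h : ∀ x, (⟪S x, x⟫_ℂ).re ≤ (⟪T x, x⟫_ℂ).re) : S ≤ T := by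
  rw [ContinuousLinearMap.le_def, ContinuousLinearMap.isPositive_def']
  refine ⟨hT.sub hS, fun x => ?_⟩
  rw [ContinuousLinearMap.reApplyInnerSelf_apply]
  simp only [sub_apply, inner_sub_left]
  change 0 ≤ (⟪T x, x⟫_ℂ - ⟪S x, x⟫_ℂ).re
  rw [Complex.sub_re]
  linarith [h x]

theorem re_inner_star_mul_self (T : E →L[ℂ] E) (x : E) :
    (⟪(star T * T) x, x⟫_ℂ).re = ‖T x‖ ^ 2 := by
  have : ⟪(star T * T) x, x⟫_ℂ = ⟪T x, T x⟫_ℂ := ContinuousLinearMap.adjoint_inner_left T x (T x)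
  rw [this]
  exact inner_self_eq_norm_sq (𝕜 := ℂ) _

theorem smul_rpow_of_nonneg {T : E →L[ℂ] E} (hT : 0 ≤ T) (c : ℝ≥0) (θ : ℝ≥0) :
    (c • T) ^ (θ : ℝ) = (c ^ (θ : ℝ)) • T ^ (θ : ℝ) := by
  have hcont : Continuous fun x : ℝ≥0 => x ^ (θ : ℝ) := NNReal.continuous_rpow_const θ.2
  rw [CFC.rpow_def, CFC.rpow_def, ← cfc_comp_smul c (fun x : ℝ≥0 => x ^ (θ : ℝ)) T
    hcont.continuousOn hT, ← cfc_const_mul (c ^ (θ : ℝ)) (fun x : ℝ≥0 => x ^ (θ : ℝ)) T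
    hcont.continuousOn]
  refine cfc_congr fun x _ => ?_
  simp [NNReal.mul_rpow]

/-- Conjugation by a unitary is a continuous star automorphism, hence commutes with the functional
calculus. -/
theorem conj_rpow {T : E →L[ℂ] E} (hT : 0 ≤ T) {U : E →L[ℂ] E} (h1 : star U * U = 1)
    (h2 : U * star U = 1) (θ : ℝ≥0) :
    (star U * T * U) ^ (θ : ℝ) = star U * T ^ (θ : ℝ) * U := by
  let u : unitary (E →L[ℂ] E) := ⟨star U, by
    rw [Unitary.mem_iff]; simp [h1, h2]⟩
  have hcont : Continuous fun x : ℝ≥0 => x ^ (θ : ℝ) := NNReal.continuous_rpow_const θ.2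
  have hφ : Continuous (Unitary.conjStarAlgAut ℂ (E →L[ℂ] E) u) := by
    have : (Unitary.conjStarAlgAut ℂ (E →L[ℂ] E) u : (E →L[ℂ] E) → (E →L[ℂ] E)) =
        fun X => star U * X * U := by
      funext X
      simp [u]
    rw [this]
    fun_prop
  have hpos : 0 ≤ star U * T * U := by
    have := star_left_conjugate_nonneg hT U
    exact this
  have hval : ∀ X, Unitary.conjStarAlgAut ℂ (E →L[ℂ] E) u X = star U * X * U := fun X => by
    simp [u]
  have h := StarAlgHomClass.map_cfc (S := ℂ) (Unitary.conjStarAlgAut ℂ (E →L[ℂ] E) u)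
    (fun x : ℝ≥0 => x ^ (θ : ℝ)) T hcont.continuousOn hφ hT (by rw [hval]; exact hpos)
  rw [hval, hval] at h
  exact h.symm

end Loewner

/-! ### Negative powers of `H`: interpolation, Heinz' inequality, cutoffs. -/

namespace PositiveOperator

variable {E : Type*} [NormedAddCommGroup E] [InnerProductSpace ℂ E] [CompleteSpace E]
  (H : PositiveOperator E)

theorem negPow_nonneg (s : ℝ≥0) : 0 ≤ H.negPow s := CFC.rpow_nonneg

theorem negPow_isSelfAdjoint (s : ℝ≥0) : IsSelfAdjoint (H.negPow s) := (H.negPow_nonneg s).isSelfAdjoint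

theorem negPow_natCast (n : ℕ) : H.negPow n = H.inv ^ n := by
  unfold negPow
  simpa using CFC.rpow_natCast H.inv n H.inv_nonneg

theorem negPow_mul (s θ : ℝ≥0) : H.negPow s ^ (θ : ℝ) = H.negPow (θ * s) := by
  unfold negPow
  rw [CFC.rpow_rpow_of_exponent_nonneg H.inv s θ s.2 θ.2 H.inv_nonneg, NNReal.coe_mul, mul_comm]

theorem commute_negPow_of_commute {T : E →L[ℂ] E} (h : Commute H.inv T) (s : ℝ≥0) :
    Commute (H.negPow s) T := h.cfc_nnreal _

theorem commute_negPow_inv (s : ℝ≥0) : Commute (H.negPow s) H.inv :=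
  H.commute_negPow_of_commute (Commute.refl _) s

theorem negPow_two_mul (s : ℝ≥0) : H.negPow (2 * s) = star (H.negPow s) * H.negPow s := by
  rw [(H.negPow_isSelfAdjoint s).star_eq, ← negPow_add, two_mul]

theorem re_inner_negPow_two_mul (s : ℝ≥0) (x : E) :
    (⟪H.negPow (2 * s) x, x⟫_ℂ).re = ‖H.negPow s x‖ ^ 2 := by
  rw [negPow_two_mul]
  exact re_inner_star_mul_self _ x

/-- The orthogonal complement of the range of a self-adjoint operator is its kernel, which is
trivial here. -/
theorem denseRange_negPow (s : ℝ≥0) : DenseRange (H.negPow s) := by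
  have h1 : (LinearMap.range (H.negPow s).toLinearMap : Submodule ℂ E)ᗮ = ⊥ := by
    rw [Submodule.eq_bot_iff]
    intro y hy
    refine H.negPow_injective s ?_
    rw [map_zero, ← inner_self_eq_zero (𝕜 := ℂ)]
    rw [inner_apply_of_isSelfAdjoint (H.negPow_isSelfAdjoint s)]
    exact (Submodule.mem_orthogonal' _ _).mp hy _ ⟨_, rfl⟩
  have h2 := (Submodule.topologicalClosure_eq_top_iff).mpr h1
  rw [← Submodule.dense_iff_topologicalClosure_eq_top] at h2
  exact h2

theorem denseRange_inv_pow (n : ℕ) : DenseRange (H.inv ^ n : E →L[ℂ] E) := by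
  rw [← negPow_natCast]
  exact H.denseRange_negPow n

theorem inv_isSelfAdjoint : IsSelfAdjoint H.inv := H.inv_nonneg.isSelfAdjoint

theorem inv_pow_injective (n : ℕ) : Function.Injective (H.inv ^ n : E →L[ℂ] E) := by
  rw [← negPow_natCast]
  exact H.negPow_injective n

/-- Young's inequality for the powers of `H`. -/
theorem young_negPow (κ θ lam : ℝ≥0) (hθ : θ ≤ 1) (x : E) :
    (lam : ℝ) ^ (1 - θ : ℝ) * ‖H.negPow (θ * κ) x‖ ^ 2 ≤
      θ * ‖H.negPow κ x‖ ^ 2 + (1 - θ) * lam * ‖x‖ ^ 2 := by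
  have hθ' : (θ : ℝ) ≤ 1 := hθ
  set T := H.negPow (2 * κ) with hT
  have hT0 : 0 ≤ T := H.negPow_nonneg _
  have hcont : Continuous fun x : ℝ≥0 => x ^ (θ : ℝ) := NNReal.continuous_rpow_const θ.2
  -- This is the scalar inequality `λ^{1-θ} x^θ ≤ θ x + (1-θ) λ`, carried over to `T = H^{-2κ}` by
  -- the functional calculus.
  have hle : (lam ^ (1 - θ : ℝ)) • T ^ (θ : ℝ) ≤ θ • T + ((1 - θ) * lam) • (1 : E →L[ℂ] E) := by
    have h1 : (lam ^ (1 - θ : ℝ)) • T ^ (θ : ℝ) =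
        cfc (fun x : ℝ≥0 => lam ^ (1 - θ : ℝ) * x ^ (θ : ℝ)) T := by
      rw [cfc_const_mul _ _ _ hcont.continuousOn]
      rfl
    have h2 : θ • T + ((1 - θ) * lam) • (1 : E →L[ℂ] E) =
        cfc (fun x : ℝ≥0 => θ * x + (1 - θ) * lam) T := by
      rw [cfc_add_const ((1 - θ) * lam) (fun x : ℝ≥0 => θ * x) T, cfc_const_mul_id θ T,
        Algebra.algebraMap_eq_smul_one]
    rw [h1, h2]
    refine cfc_mono (fun x _ => ?_)
      (continuous_const.mul hcont).continuousOn (by fun_prop)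
    have h3 := NNReal.geom_mean_le_arith_mean2_weighted θ (1 - θ) x lam
      (add_tsub_cancel_of_le hθ)
    rw [NNReal.coe_sub hθ] at h3
    rw [mul_comm]
    exact h3
  have h4 := re_inner_le_of_le hle x
  have h5 : T ^ (θ : ℝ) = H.negPow (2 * (θ * κ)) := by
    rw [hT, negPow_mul]; congr 1; ring
  rw [h5] at h4
  have hsm : ∀ (c : ℝ≥0) (S : E →L[ℂ] E), (⟪(c • S) x, x⟫_ℂ).re = c * (⟪S x, x⟫_ℂ).re := by
    intro c S
    have : (c • S) x = ((c : ℝ) : ℂ) • S x := rfl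
    rw [this, inner_smul_left]
    simp
  rw [add_apply, inner_add_left, Complex.add_re, hsm, hsm, hsm, hT, re_inner_negPow_two_mul,
    re_inner_negPow_two_mul] at h4
  have h6 : (⟪(1 : E →L[ℂ] E) x, x⟫_ℂ).re = ‖x‖ ^ 2 := inner_self_eq_norm_sq (𝕜 := ℂ) x
  rw [h6, NNReal.coe_rpow, NNReal.coe_mul, NNReal.coe_sub hθ] at h4
  simpa using h4

/-- The interpolation inequality `‖H^{-θκ} x‖ ≤ ‖x‖^{1-θ} ‖H^{-κ} x‖^θ`. -/
theorem norm_negPow_interpolation (κ θ : ℝ≥0) (hθ : θ ≤ 1) (x : E) :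
    ‖H.negPow (θ * κ) x‖ ≤ ‖x‖ ^ (1 - θ : ℝ) * ‖H.negPow κ x‖ ^ (θ : ℝ) := by
  rcases eq_or_ne x 0 with rfl | hx
  · simp only [map_zero, norm_zero]
    positivity
  have ha : 0 < ‖H.negPow κ x‖ := by
    rw [norm_pos_iff]
    exact fun h => hx (H.negPow_injective κ (by rw [h, map_zero]))
  have hb : 0 < ‖x‖ := norm_pos_iff.mpr hx
  set a := ‖H.negPow κ x‖
  set b := ‖x‖
  have hr : 0 < a / b := div_pos ha hb
  -- This value of `λ` balances both terms on the right of Young's inequality, whose sum becomes `a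
  -- ^ 2`.
  obtain ⟨l, h1⟩ : ∃ l : ℝ≥0, (l : ℝ) = (a / b) ^ 2 := ⟨⟨_, by positivity⟩, rfl⟩
  have h := H.young_negPow κ θ l hθ x
  rw [h1] at h
  have h2 : (θ : ℝ) * a ^ 2 + (1 - θ) * (a / b) ^ 2 * b ^ 2 = a ^ 2 := by
    field_simp
    ring
  have h3 : ((a / b) ^ 2) ^ (1 - θ : ℝ) = ((a / b) ^ (1 - θ : ℝ)) ^ 2 := by
    rw [← Real.rpow_natCast, ← Real.rpow_natCast, ← Real.rpow_mul hr.le, ← Real.rpow_mul hr.le,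
      mul_comm]
  rw [show (θ : ℝ) * ‖H.negPow κ x‖ ^ 2 + (1 - θ) * (a / b) ^ 2 * ‖x‖ ^ 2 = a ^ 2 from h2, h3,
    ← mul_pow] at h
  have h4 := (sq_le_sq₀ (by positivity) ha.le).mp h
  rw [Real.div_rpow ha.le hb.le, div_mul_eq_mul_div, div_le_iff₀ (by positivity)] at h4
  have h5 : a = a ^ (1 - θ : ℝ) * a ^ (θ : ℝ) := by
    rw [← Real.rpow_add ha]; simp
  have h6 : 0 < a ^ (1 - θ : ℝ) := by positivity
  have h7 : a * b ^ (1 - θ : ℝ) = a ^ (1 - θ : ℝ) * (b ^ (1 - θ : ℝ) * a ^ (θ : ℝ)) := by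
    conv_lhs => rw [h5]
    ring
  rw [h7] at h4
  exact le_of_mul_le_mul_left h4 h6

/-- Heinz' inequality for a unitary operator. -/
theorem norm_negPow_apply_le_rpow {U : E →L[ℂ] E} (h1 : star U * U = 1) (h2 : U * star U = 1)
    {κ θ M : ℝ≥0} (hθ : θ ≤ 1) (h : ∀ x, ‖H.negPow κ (U x)‖ ≤ M * ‖H.negPow κ x‖) (x : E) :
    ‖H.negPow (θ * κ) (U x)‖ ≤ (M : ℝ) ^ (θ : ℝ) * ‖H.negPow (θ * κ) x‖ := by
  have hconj : ∀ (s : ℝ≥0) (x : E), (⟪(star U * H.negPow (2 * s) * U) x, x⟫_ℂ).re =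
      ‖H.negPow s (U x)‖ ^ 2 := by
    intro s x
    have : star U * H.negPow (2 * s) * U = star (H.negPow s * U) * (H.negPow s * U) := by
      rw [star_mul, negPow_two_mul]
      simp only [mul_assoc]
    rw [this, re_inner_star_mul_self]
    rfl
  have hsm : ∀ (c : ℝ≥0) (S : E →L[ℂ] E) (x : E),
      (⟪(c • S) x, x⟫_ℂ).re = c * (⟪S x, x⟫_ℂ).re := by
    intro c S x
    have : (c • S) x = ((c : ℝ) : ℂ) • S x := rfl
    rw [this, inner_smul_left]
    simp
  have hle : star U * H.negPow (2 * κ) * U ≤ (M ^ 2) • H.negPow (2 * κ) := by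
    refine le_of_re_inner_le ?_ ?_ fun x => ?_
    · exact (star_left_conjugate_nonneg (H.negPow_nonneg _) U).isSelfAdjoint
    · exact (IsSelfAdjoint.all (M ^ 2)).smul (H.negPow_isSelfAdjoint _)
    · rw [hconj, hsm, re_inner_negPow_two_mul, NNReal.coe_pow, ← mul_pow]
      gcongr
      exact h x
  -- Operator monotonicity of `x ↦ x^θ`, the reason for `θ ≤ 1`.
  have h3 := CFC.rpow_le_rpow (p := (θ : ℝ)) ⟨θ.2, hθ⟩ hle
  rw [conj_rpow (H.negPow_nonneg _) h1 h2, smul_rpow_of_nonneg (H.negPow_nonneg _),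
    negPow_mul] at h3
  have h4 : θ * (2 * κ) = 2 * (θ * κ) := by ring
  rw [h4] at h3
  have h5 := re_inner_le_of_le h3 x
  rw [hconj, hsm, re_inner_negPow_two_mul] at h5
  have h6 : (((M ^ 2) ^ (θ : ℝ) : ℝ≥0) : ℝ) = ((M : ℝ) ^ (θ : ℝ)) ^ 2 := by
    rw [NNReal.coe_rpow, NNReal.coe_pow, ← Real.rpow_natCast, ← Real.rpow_natCast,
      ← Real.rpow_mul M.coe_nonneg, ← Real.rpow_mul M.coe_nonneg, mul_comm]
  rw [h6, ← mul_pow] at h5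
  exact (sq_le_sq₀ (norm_nonneg _) (by positivity)).mp h5

/-- A bound of `T*` for the negative norm yields a factorization of `T` on the range of the
negative power. -/
theorem exists_mul_negPow_eq {T : E →L[ℂ] E} {κ : ℝ≥0} {M : ℝ} (hM : 0 ≤ M)
    (h : ∀ x, ‖H.negPow κ (star T x)‖ ≤ M * ‖H.negPow κ x‖) :
    ∃ Z : E →L[ℂ] E, ‖Z‖ ≤ M ∧ T * H.negPow κ = H.negPow κ * Z := by
  -- By hypothesis `H^{-κ} T* H^κ` is bounded on the dense range of `H^{-κ}`. The adjoint of its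
  -- extension is `Z = H^κ T H^{-κ}`.
  let f : E →ₗ[ℂ] E := (H.negPow κ * star T).toLinearMap
  let e : E →ₗ[ℂ] E := (H.negPow κ).toLinearMap
  have hd : DenseRange e := H.denseRange_negPow κ
  have hfe : ∀ x, ‖f x‖ ≤ M * ‖e x‖ := h
  refine ⟨star (f.extendOfNorm e), ?_, ?_⟩
  · rw [norm_star]
    exact LinearMap.opNorm_extendOfNorm_le hd hM hfe
  · have h1 : f.extendOfNorm e * H.negPow κ = H.negPow κ * star T := by
      ext x
      exact LinearMap.extendOfNorm_eq hd ⟨M, hfe⟩ x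
    have h2 := congrArg star h1
    rw [star_mul, star_mul, star_star, (H.negPow_isSelfAdjoint κ).star_eq] at h2
    exact h2.symm

/-- The cut off inverse `max(H⁻¹, ε)⁻¹`. -/
noncomputable def cutoff (ε : ℝ) : E →L[ℂ] E := cfc (fun x : ℝ => (max x ε)⁻¹) H.inv

theorem cutoff_isSelfAdjoint (ε : ℝ) : IsSelfAdjoint (H.cutoff ε) := cfc_predicate _ _

theorem commute_inv_cutoff (ε : ℝ) : Commute H.inv (H.cutoff ε) :=
  ((Commute.refl H.inv).cfc_real _).symm

/-- The smoothing approximation `(H⁻¹ max(H⁻¹, ε)⁻¹)^N` of the identity. -/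
noncomputable def smoothing (N : ℕ) (ε : ℝ) : E →L[ℂ] E := (H.inv * H.cutoff ε) ^ N

theorem smoothing_eq (N : ℕ) (ε : ℝ) : H.smoothing N ε = H.inv ^ N * H.cutoff ε ^ N :=
  (H.commute_inv_cutoff ε).mul_pow N

theorem smoothing_eq_cfc (N : ℕ) {ε : ℝ} (hε : 0 < ε) :
    H.smoothing N ε = cfc (fun x : ℝ => (x * (max x ε)⁻¹) ^ N) H.inv := by
  have hc : Continuous fun x : ℝ => (max x ε)⁻¹ :=
    (continuous_id.max continuous_const).inv₀ fun x => (lt_max_of_lt_right hε).ne'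
  have hsa := H.inv_isSelfAdjoint
  rw [cfc_pow (fun x : ℝ => x * (max x ε)⁻¹) N _ (continuous_id.mul hc).continuousOn hsa,
    cfc_mul (fun x : ℝ => x) (fun x : ℝ => (max x ε)⁻¹) _ continuousOn_id hc.continuousOn, cfc_id' ℝ H.inv hsa]
  rfl

theorem cutoff_ratio_mem {x ε : ℝ} (hx : 0 ≤ x) (hε : 0 < ε) (N : ℕ) :
    0 ≤ (x * (max x ε)⁻¹) ^ N ∧ (x * (max x ε)⁻¹) ^ N ≤ 1 := by
  have hm : 0 < max x ε := lt_max_of_lt_right hε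
  have h1 : x * (max x ε)⁻¹ ≤ 1 := by
    rw [← div_eq_mul_inv, div_le_one hm]
    exact le_max_left _ _
  exact ⟨by positivity, pow_le_one₀ (by positivity) h1⟩

theorem norm_smoothing_le (N : ℕ) {ε : ℝ} (hε : 0 < ε) : ‖H.smoothing N ε‖ ≤ 1 := by
  rw [smoothing_eq_cfc H N hε]
  refine norm_cfc_le zero_le_one fun x hx => ?_
  have h := cutoff_ratio_mem (spectrum_nonneg_of_nonneg H.inv_nonneg hx) hε N
  rw [Real.norm_of_nonneg h.1]
  exact h.2

/-- The symbol `1 - (x / max x ε)^N` vanishes for `x ≥ ε` and lies in `[0, 1]` for `0 ≤ x ≤ ε`. This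
is the rate at which the regularization is removed, at the price of one power of `H⁻¹`. -/
theorem norm_one_sub_smoothing_mul_inv_le (N : ℕ) {ε : ℝ} (hε : 0 < ε) :
    ‖(1 - H.smoothing N ε) * H.inv‖ ≤ ε := by
  have hc : Continuous fun x : ℝ => (x * (max x ε)⁻¹) ^ N :=
    (continuous_id.mul ((continuous_id.max continuous_const).inv₀ fun x =>
      (lt_max_of_lt_right hε).ne')).pow N
  have hsa := H.inv_isSelfAdjoint
  have h1 : (1 - H.smoothing N ε) * H.inv =
      cfc (fun x : ℝ => (1 - (x * (max x ε)⁻¹) ^ N) * x) H.inv := by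
    rw [cfc_mul (fun x : ℝ => 1 - (x * (max x ε)⁻¹) ^ N) (fun x : ℝ => x) _
        (continuous_const.sub hc).continuousOn continuousOn_id,
      cfc_sub (fun _ : ℝ => (1 : ℝ)) (fun x : ℝ => (x * (max x ε)⁻¹) ^ N) _ continuousOn_const
        hc.continuousOn, cfc_const 1 H.inv hsa, cfc_id' ℝ H.inv hsa, smoothing_eq_cfc H N hε,
      map_one]
  rw [h1]
  refine norm_cfc_le hε.le fun x hx => ?_
  have hx0 := spectrum_nonneg_of_nonneg H.inv_nonneg hx
  have h := cutoff_ratio_mem hx0 hε N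
  rw [Real.norm_of_nonneg (mul_nonneg (by linarith) hx0)]
  rcases le_total ε x with hle | hle
  · have hx' : 0 < x := hε.trans_le hle
    rw [max_eq_left hle, mul_inv_cancel₀ hx'.ne']
    simpa using hε.le
  · nlinarith

end PositiveOperator

/-! ### The energy estimate and the Japanese bracket. -/

section Growth

variable {E : Type*} [NormedAddCommGroup E] [InnerProductSpace ℂ E] [CompleteSpace E]

theorem re_inner_neg_I_smul_apply {G : E →L[ℂ] E} (hG : IsSelfAdjoint G) (x : E) :
    (⟪-Complex.I • G x, x⟫_ℂ).re = 0 := by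
  have h1 : (⟪G x, x⟫_ℂ).im = 0 := by
    rw [← Complex.conj_eq_iff_im, inner_conj_symm, inner_apply_of_isSelfAdjoint hG]
  rw [inner_smul_left]
  simp [h1]

theorem hasDerivAt_norm_sq_complex {E : Type*} [NormedAddCommGroup E] [InnerProductSpace ℂ E]
    {v : ℝ → E} {v' : E} {t : ℝ} (hv : HasDerivAt v v' t) :
    HasDerivAt (fun t => ‖v t‖ ^ 2) (2 * (⟪v', v t⟫_ℂ).re) t := by
  have h1 := hv.inner ℂ hv
  have h2 := Complex.reCLM.hasFDerivAt.comp_hasDerivAt t h1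
  have h3 : (Complex.reCLM ∘ fun t => ⟪v t, v t⟫_ℂ) = fun t => ‖v t‖ ^ 2 := by
    funext t
    exact inner_self_eq_norm_sq (𝕜 := ℂ) (v t)
  rw [h3] at h2
  refine h2.congr_deriv ?_
  rw [Complex.reCLM_apply, Complex.add_re, ← inner_conj_symm (v t) v', Complex.conj_re]
  ring

/-- Energy estimate: a sublinear perturbation of a Schrödinger equation produces polynomial
growth only. -/
theorem rpow_norm_le_of_hasDerivAt {G : ℝ → E →L[ℂ] E} (hG : ∀ t, IsSelfAdjoint (G t))
    {v g : ℝ → E} (hv : ∀ t, HasDerivAt v (-Complex.I • G t (v t) + g t) t)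
    (hne : ∀ t, v t ≠ 0) {θ D : ℝ} (hθ : 0 < θ)
    (hg : ∀ t, ‖g t‖ ≤ D * ‖v t‖ ^ (1 - θ)) (t s : ℝ) :
    ‖v t‖ ^ θ ≤ ‖v s‖ ^ θ + θ * D * |t - s| := by
  have hpos : ∀ t, 0 < ‖v t‖ := fun t => norm_pos_iff.mpr (hne t)
  -- The square of the norm is differentiable and nonzero, so `‖v‖^θ` is differentiated as a power
  -- of it.
  have hsq : ∀ t, (‖v t‖ ^ 2) ^ (θ / 2) = ‖v t‖ ^ θ := fun t => by
    rw [← Real.rpow_natCast, ← Real.rpow_mul (hpos t).le]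
    congr 1
    push_cast
    ring
  have hd : ∀ t, HasDerivAt (fun t => ‖v t‖ ^ θ)
      (2 * (⟪g t, v t⟫_ℂ).re * (θ / 2) * (‖v t‖ ^ 2) ^ (θ / 2 - 1)) t := by
    intro t
    have h1 := (hasDerivAt_norm_sq_complex (hv t)).rpow_const (p := θ / 2)
      (Or.inl (pow_pos (hpos t) 2).ne')
    simp only [hsq] at h1
    rw [inner_add_left, Complex.add_re, re_inner_neg_I_smul_apply (hG t), zero_add] at h1
    exact h1
  have hb : ∀ t, ‖2 * (⟪g t, v t⟫_ℂ).re * (θ / 2) * (‖v t‖ ^ 2) ^ (θ / 2 - 1)‖ ≤ θ * D := by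
    intro t
    have h1 : |(⟪g t, v t⟫_ℂ).re| ≤ D * ‖v t‖ ^ (1 - θ) * ‖v t‖ :=
      (Complex.abs_re_le_norm _).trans ((norm_inner_le_norm _ _).trans
        (mul_le_mul_of_nonneg_right (hg t) (norm_nonneg _)))
    have h2 : (‖v t‖ ^ 2) ^ (θ / 2 - 1) = ‖v t‖ ^ (θ - 2) := by
      rw [← Real.rpow_natCast, ← Real.rpow_mul (hpos t).le]
      congr 1
      push_cast
      ring
    -- The exponents `1 - θ`, `1` and `θ - 2` add up to zero, so the derivative of `‖v‖^θ` is
    -- bounded by a constant.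
    have h3 : ‖v t‖ ^ (1 - θ) * ‖v t‖ * ‖v t‖ ^ (θ - 2) = 1 := by
      rw [← Real.rpow_add_one (hpos t).ne', ← Real.rpow_add (hpos t)]
      ring_nf
      exact Real.rpow_zero _
    rw [h2, norm_mul, norm_mul, norm_mul, Real.norm_of_nonneg (Real.rpow_nonneg (hpos t).le _),
      Real.norm_of_nonneg (by positivity : 0 ≤ θ / 2), Real.norm_eq_abs, Real.norm_eq_abs, abs_two]
    calc 2 * |(⟪g t, v t⟫_ℂ).re| * (θ / 2) * ‖v t‖ ^ (θ - 2)
        ≤ 2 * (D * ‖v t‖ ^ (1 - θ) * ‖v t‖) * (θ / 2) * ‖v t‖ ^ (θ - 2) := by gcongr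
      _ = θ * D * (‖v t‖ ^ (1 - θ) * ‖v t‖ * ‖v t‖ ^ (θ - 2)) := by ring
      _ = θ * D := by rw [h3, mul_one]
  have h := Convex.norm_image_sub_le_of_norm_hasDerivWithin_le (f := fun t => ‖v t‖ ^ θ)
    (s := Set.univ) (fun t _ => (hd t).hasDerivWithinAt) (fun t _ => hb t) convex_univ
    (Set.mem_univ s) (Set.mem_univ t)
  rw [Real.norm_eq_abs, Real.norm_eq_abs] at h
  linarith [le_abs_self (‖v t‖ ^ θ - ‖v s‖ ^ θ)]

end Growth

theorem one_le_japaneseBracket (x : ℝ) : 1 ≤ japaneseBracket x := by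
  unfold japaneseBracket
  rw [Real.one_le_sqrt]
  nlinarith [sq_nonneg x]

theorem abs_le_japaneseBracket (x : ℝ) : |x| ≤ japaneseBracket x := by
  unfold japaneseBracket
  refine Real.abs_le_sqrt ?_
  linarith

theorem japaneseBracket_mono {x y : ℝ} (h : |x| ≤ |y|) : japaneseBracket x ≤ japaneseBracket y := by
  unfold japaneseBracket
  refine Real.sqrt_le_sqrt ?_
  linarith [sq_le_sq.mpr h]

/-! ### The bounded model, regularized generators and their uniform growth. -/

namespace PositiveOperator

variable {E : Type*} [NormedAddCommGroup E] [InnerProductSpace ℂ E] [CompleteSpace E]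
  (H : PositiveOperator E)

/-- The bounded operators `Λ(t) = L(t) H^{-m}` and `B(t)`, with `[L(t), H] = B(t) H^{1-δ}` written
without unbounded operators. -/
structure IsBoundedModel (m : ℕ) (δ : ℝ≥0) (Λ B : ℝ → E →L[ℂ] E) : Prop where
  bddCont : IsBddCont Λ
  isSelfAdjoint : ∀ t, IsSelfAdjoint (H.inv ^ m * Λ t)
  commutator : ∀ t, H.inv * Λ t - Λ t * H.inv = H.inv * B t * H.inv ^ m * H.negPow δ

/-- `H^i B(·) H^{-i}` is uniformly bounded. -/
def BoundedLift (B : ℝ → E →L[ℂ] E) (i : ℕ) : Prop :=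
  ∃ (B' : ℝ → E →L[ℂ] E) (C : ℝ), (∀ t, ‖B' t‖ ≤ C) ∧ ∀ t, B t * H.inv ^ i = H.inv ^ i * B' t

/-- The regularized generator `R L(t) R`, conjugated by `H^K`. -/
noncomputable def regGen (Λ : ℝ → E →L[ℂ] E) (m N K : ℕ) (ε t : ℝ) : E →L[ℂ] E :=
  H.inv ^ (N - K) * H.cutoff ε ^ N * Λ t * H.inv ^ K * (H.inv ^ (N - m) * H.cutoff ε ^ N)

variable {H} {m N K : ℕ} {δ : ℝ≥0} {Λ B : ℝ → E →L[ℂ] E} {ε : ℝ}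

theorem inv_pow_mul_cutoff_pow (i j : ℕ) :
    H.inv ^ i * H.cutoff ε ^ j = H.cutoff ε ^ j * H.inv ^ i :=
  ((H.commute_inv_cutoff ε).pow_pow i j).eq

/-- All factors other than `Λ t` are functions of `H` and commute. The condition `K' ≤ N` keeps the
exponents `N - K` and `N - K'` from being truncated. -/
theorem pow_regGen {K' : ℕ} (hK : K ≤ K') (hN : K' ≤ N) (t : ℝ) :
    H.inv ^ (K' - K) * H.regGen Λ m N K' ε t = H.regGen Λ m N K ε t * H.inv ^ (K' - K) := by
  have h1 : H.inv ^ (N - K) = H.inv ^ (K' - K) * H.inv ^ (N - K') := by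
    rw [← pow_add]; congr 1; omega
  have h2 : H.inv ^ K' = H.inv ^ K * H.inv ^ (K' - K) := by
    rw [← pow_add]; congr 1; omega
  have h3 : H.inv ^ (K' - K) * (H.inv ^ (N - m) * H.cutoff ε ^ N) =
      H.inv ^ (N - m) * H.cutoff ε ^ N * H.inv ^ (K' - K) := by
    rw [← mul_assoc, pow_mul_comm, mul_assoc, inv_pow_mul_cutoff_pow, mul_assoc]
  unfold regGen
  calc _ = H.inv ^ (K' - K) * H.inv ^ (N - K') * H.cutoff ε ^ N * Λ t * H.inv ^ K *
        (H.inv ^ (K' - K) * (H.inv ^ (N - m) * H.cutoff ε ^ N)) := by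
          rw [h2]; simp only [mul_assoc]
    _ = _ := by rw [h3, ← h1]; simp only [mul_assoc]

theorem regGen_zero (t : ℝ) : H.regGen Λ m N 0 ε t =
    H.smoothing N ε * Λ t * (H.inv ^ (N - m) * H.cutoff ε ^ N) := by
  unfold regGen
  rw [smoothing_eq, Nat.sub_zero, pow_zero, mul_one]

/-- The factor `H.inv ^ (N - m) * H.cutoff ε ^ N` is `H^m R`, where `R` is the smoothing. -/
theorem regularizer_mul_pow {i : ℕ} (hN : m ≤ N) :
    H.inv ^ (N - m) * H.cutoff ε ^ N * H.inv ^ (m + i) = H.smoothing N ε * H.inv ^ i := by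
  rw [smoothing_eq, mul_assoc, ← inv_pow_mul_cutoff_pow, ← mul_assoc, ← pow_add, mul_assoc,
    ← inv_pow_mul_cutoff_pow, ← mul_assoc, ← pow_add]
  congr 2
  omega

theorem regGen_isBddCont (hΛ : IsBddCont Λ) : IsBddCont (H.regGen Λ m N K ε) := by
  obtain ⟨hc, C, hC⟩ := hΛ
  refine ⟨?_, ‖H.inv ^ (N - K) * H.cutoff ε ^ N‖ * C *
    ‖H.inv ^ K * (H.inv ^ (N - m) * H.cutoff ε ^ N)‖, fun t => ?_⟩
  · unfold regGen
    fun_prop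
  · unfold regGen
    rw [mul_assoc _ (H.inv ^ K)]
    refine (norm_mul_le _ _).trans ?_
    gcongr
    refine (norm_mul_le _ _).trans ?_
    gcongr
    exact hC t

namespace IsBoundedModel

variable (hM : H.IsBoundedModel m δ Λ B)

include hM

/-- With `X = H^m R`, the generator is `X* (H^{-m} Λ) X`. -/
theorem regGen_zero_isSelfAdjoint (hN : m ≤ N) (t : ℝ) :
    IsSelfAdjoint (H.regGen Λ m N 0 ε t) := by
  have h1 : H.regGen Λ m N 0 ε t = star (H.inv ^ (N - m) * H.cutoff ε ^ N) *
      (H.inv ^ m * Λ t) * (H.inv ^ (N - m) * H.cutoff ε ^ N) := by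
    rw [regGen_zero, star_mul, star_pow, star_pow, H.inv_isSelfAdjoint.star_eq,
      (H.cutoff_isSelfAdjoint ε).star_eq, smoothing_eq, inv_pow_mul_cutoff_pow]
    have : H.inv ^ N = H.inv ^ (N - m) * H.inv ^ m := by rw [← pow_add]; congr 1; omega
    rw [this]
    simp only [mul_assoc]
  rw [h1]
  exact (hM.isSelfAdjoint t).conjugate' _

/-- Moving `Λ` past the factors of `H⁻¹` one at a time costs a commutator each time. The lift of `B`
past `H^{-i}` brings that error behind `H^{-K}`, and `S` is the sum of the lifts for `i < K`. Every
error keeps the same gain `H^{-m} H^{-δ}`. -/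
theorem exists_mul_pow_eq (hK : ∀ i < K, H.BoundedLift B i) :
    ∃ (S : ℝ → E →L[ℂ] E) (C : ℝ), 0 ≤ C ∧ (∀ t, ‖S t‖ ≤ C) ∧
      ∀ t, Λ t * H.inv ^ K = H.inv ^ K * (Λ t - S t * H.inv ^ m * H.negPow δ) := by
  induction K with
  | zero => exact ⟨0, 0, le_rfl, by simp, by simp⟩
  | succ K ih =>
    obtain ⟨S, C, hC0, hC, hS⟩ := ih fun i hi => hK i (hi.trans (Nat.lt_succ_self K))
    obtain ⟨B', C', hC', hB'⟩ := hK K (Nat.lt_succ_self K)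
    have hC0' : 0 ≤ C' := (norm_nonneg _).trans (hC' 0)
    refine ⟨fun t => S t + B' t, C + C', by positivity,
      fun t => (norm_add_le _ _).trans (add_le_add (hC t) (hC' t)), fun t => ?_⟩
    have h1 : Λ t * H.inv = H.inv * Λ t - H.inv * B t * H.inv ^ m * H.negPow δ := by
      rw [← hM.commutator t]; abel
    have h2 : H.negPow δ * H.inv ^ K = H.inv ^ K * H.negPow δ :=
      ((H.commute_negPow_inv δ).pow_right K).eq
    calc Λ t * H.inv ^ (K + 1) = Λ t * H.inv * H.inv ^ K := by rw [pow_succ', mul_assoc]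
      _ = H.inv * (Λ t * H.inv ^ K) -
            H.inv * B t * H.inv ^ m * (H.negPow δ * H.inv ^ K) := by
          rw [h1]; noncomm_ring
      _ = H.inv * (H.inv ^ K * (Λ t - S t * H.inv ^ m * H.negPow δ)) -
            H.inv * B t * (H.inv ^ m * H.inv ^ K) * H.negPow δ := by
          rw [hS, h2]; simp only [mul_assoc]
      _ = H.inv * (H.inv ^ K * (Λ t - S t * H.inv ^ m * H.negPow δ)) -
            H.inv * (B t * H.inv ^ K) * H.inv ^ m * H.negPow δ := by
          rw [pow_mul_comm]; simp only [mul_assoc]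
      _ = _ := by rw [hB', pow_succ']; noncomm_ring

/-- The perturbation created by conjugation with `H^K` gains `H^{-δ}`, and `S` and `C` are chosen
before `N` and `ε`: this uniformity is what survives the limit. -/
theorem exists_regGen_eq (hK : ∀ i < K, H.BoundedLift B i) :
    ∃ (S : ℝ → E →L[ℂ] E) (C : ℝ), 0 ≤ C ∧ (∀ t, ‖S t‖ ≤ C) ∧
      ∀ N ε t, m ≤ N → K ≤ N → H.regGen Λ m N K ε t = H.regGen Λ m N 0 ε t -
        H.smoothing N ε * S t * H.smoothing N ε * H.negPow δ := by
  obtain ⟨S, C, hC0, hC, hS⟩ := hM.exists_mul_pow_eq hK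
  refine ⟨S, C, hC0, hC, fun N ε t hm hN => ?_⟩
  have h1 : H.inv ^ (N - K) * H.cutoff ε ^ N * H.inv ^ K = H.smoothing N ε := by
    have := regularizer_mul_pow (H := H) (ε := ε) (i := 0) hN
    simpa using this
  have h2 : H.inv ^ m * H.negPow δ * (H.inv ^ (N - m) * H.cutoff ε ^ N) =
      H.smoothing N ε * H.negPow δ := by
    have hc : Commute (H.negPow δ) (H.inv ^ (N - m) * H.cutoff ε ^ N) :=
      H.commute_negPow_of_commute (((Commute.refl _).pow_right _).mul_right
        ((H.commute_inv_cutoff ε).pow_right N)) δ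
    rw [mul_assoc, hc.eq, ← mul_assoc, ← mul_assoc, ← pow_add, smoothing_eq]
    congr 3
    omega
  calc H.regGen Λ m N K ε t = H.inv ^ (N - K) * H.cutoff ε ^ N * (Λ t * H.inv ^ K) *
        (H.inv ^ (N - m) * H.cutoff ε ^ N) := by
          unfold regGen; simp only [mul_assoc]
    _ = H.inv ^ (N - K) * H.cutoff ε ^ N * H.inv ^ K * Λ t * (H.inv ^ (N - m) * H.cutoff ε ^ N) -
        H.inv ^ (N - K) * H.cutoff ε ^ N * H.inv ^ K * S t *
          (H.inv ^ m * H.negPow δ * (H.inv ^ (N - m) * H.cutoff ε ^ N)) := by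
          rw [hS]; noncomm_ring
    _ = _ := by rw [h1, h2, regGen_zero]; simp only [mul_assoc]

/-- Uniform polynomial growth of the regularized flow, conjugated by `H^K`. -/
theorem exists_norm_evolution_le (hK : ∀ i < K, H.BoundedLift B i) {θ : ℝ≥0} (hθ : 0 < θ)
    (hθ1 : θ ≤ 1) (hθK : θ * K ≤ δ) :
    ∃ C : ℝ, 0 < C ∧ ∀ N ε, m ≤ N → K ≤ N → 0 < ε → ∀ t s,
      ‖evolution (H.regGen Λ m N K ε) t s‖ ≤ (C * japaneseBracket (t - s)) ^ (1 / θ : ℝ) := by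
  obtain ⟨S, C, hC0, hC, hS⟩ := hM.exists_regGen_eq hK
  set c := ‖H.negPow (δ - θ * K)‖ with hc
  set a := ‖(H.inv ^ K : E →L[ℂ] E)‖ with ha
  refine ⟨1 + θ * (C * c * a ^ (θ : ℝ)), by positivity, fun N ε hm hN hε t s => ?_⟩
  have hbc : IsBddCont (H.regGen Λ m N K ε) := regGen_isBddCont hM.bddCont
  have hbc0 : IsBddCont (H.regGen Λ m N 0 ε) := regGen_isBddCont hM.bddCont
  have hjb := one_le_japaneseBracket (t - s)
  refine ContinuousLinearMap.opNorm_le_bound _ (by positivity) fun x => ?_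
  rcases eq_or_ne x 0 with rfl | hx
  · simp
  set v := fun t => evolution (H.regGen Λ m N K ε) t s x with hv
  have hvs : v s = x := by simp [hv, hbc.evolution_self]
  -- `H^{-K} v` follows the unconjugated regularized flow, which is unitary.
  have hpow : ∀ t, ‖(H.inv ^ K : E →L[ℂ] E) (v t)‖ = ‖(H.inv ^ K : E →L[ℂ] E) x‖ := by
    intro t
    have h1 := hbc0.evolution_intertwine hbc (X := H.inv ^ K)
      (fun t => by simpa using pow_regGen (H := H) (Λ := Λ) (m := m) (ε := ε) (Nat.zero_le K) hN t) t s
    have h2 := congrArg (fun T : E →L[ℂ] E => T x) h1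
    have h3 : (H.inv ^ K : E →L[ℂ] E) (v t) =
      evolution (H.regGen Λ m N 0 ε) t s ((H.inv ^ K : E →L[ℂ] E) x) := h2
    rw [h3, hbc0.norm_evolution_apply (fun t => hM.regGen_zero_isSelfAdjoint hm t)]
  have hxK : ‖(H.inv ^ K : E →L[ℂ] E) x‖ ≠ 0 := by
    rw [norm_ne_zero_iff]
    exact fun h => hx (H.inv_pow_injective K (by rw [h, map_zero]))
  have hne : ∀ t, v t ≠ 0 := fun t h => hxK (by rw [← hpow t, h, map_zero, norm_zero])
  have hder : ∀ t, HasDerivAt v (-Complex.I • H.regGen Λ m N 0 ε t (v t) +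
      Complex.I • (H.smoothing N ε * S t * H.smoothing N ε * H.negPow δ) (v t)) t := by
    intro t
    refine (hbc.hasDerivAt_evolution_apply t s x).congr_deriv ?_
    rw [hS N ε t hm hN, sub_apply, smul_sub]
    simp only [neg_smul, sub_neg_eq_add]
    rfl
  set q := ‖(H.inv ^ K : E →L[ℂ] E) x‖ with hq
  have hg : ∀ t, ‖Complex.I • (H.smoothing N ε * S t * H.smoothing N ε * H.negPow δ) (v t)‖ ≤
      C * c * q ^ (θ : ℝ) * ‖v t‖ ^ (1 - θ : ℝ) := by
    intro t
    have h1 : ‖H.smoothing N ε * S t * H.smoothing N ε‖ ≤ C := by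
      have hR := H.norm_smoothing_le N hε
      calc _ ≤ ‖H.smoothing N ε‖ * ‖S t‖ * ‖H.smoothing N ε‖ :=
            (norm_mul_le _ _).trans (mul_le_mul_of_nonneg_right (norm_mul_le _ _) (norm_nonneg _))
        _ ≤ 1 * C * 1 := by gcongr; exact hC t
        _ = C := by ring
    -- Split `δ = (δ - θ K) + θ K` and interpolate `H^{-θK} v` between `v` and `H^{-K} v`, the
    -- latter of constant norm `q`.
    have h2 : ‖H.negPow δ (v t)‖ ≤ c * (‖v t‖ ^ (1 - θ : ℝ) * q ^ (θ : ℝ)) := by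
      have h3 : H.negPow δ = H.negPow (δ - θ * K) * H.negPow (θ * K) := by
        rw [← negPow_add, tsub_add_cancel_of_le hθK]
      rw [h3]
      refine ((H.negPow (δ - θ * K)).le_opNorm _).trans ?_
      refine mul_le_mul_of_nonneg_left ?_ (norm_nonneg _)
      have h4 := H.norm_negPow_interpolation K θ hθ1 (v t)
      rwa [negPow_natCast, hpow] at h4
    rw [norm_smul, Complex.norm_I, one_mul]
    calc ‖(H.smoothing N ε * S t * H.smoothing N ε) (H.negPow δ (v t))‖
        ≤ C * (c * (‖v t‖ ^ (1 - θ : ℝ) * q ^ (θ : ℝ))) :=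
          (ContinuousLinearMap.le_opNorm _ _).trans (by gcongr)
      _ = _ := by ring
  have hmain := rpow_norm_le_of_hasDerivAt (fun t => hM.regGen_zero_isSelfAdjoint hm t) hder hne
    (NNReal.coe_pos.mpr hθ) hg t s
  rw [hvs] at hmain
  -- This makes the estimate homogeneous in `x`, so that the root of order `θ` yields an operator
  -- norm bound.
  have hqa : q ^ (θ : ℝ) ≤ a ^ (θ : ℝ) * ‖x‖ ^ (θ : ℝ) := by
    rw [← Real.mul_rpow (norm_nonneg _) (norm_nonneg _)]
    exact Real.rpow_le_rpow (norm_nonneg _) (ContinuousLinearMap.le_opNorm _ _) θ.2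
  have hfin : ‖v t‖ ^ (θ : ℝ) ≤
      (1 + θ * (C * c * a ^ (θ : ℝ))) * japaneseBracket (t - s) * ‖x‖ ^ (θ : ℝ) := by
    calc ‖v t‖ ^ (θ : ℝ) ≤ ‖x‖ ^ (θ : ℝ) + θ * (C * c * q ^ (θ : ℝ)) * |t - s| := hmain
      _ ≤ 1 * ‖x‖ ^ (θ : ℝ) * japaneseBracket (t - s) +
          θ * (C * c * (a ^ (θ : ℝ) * ‖x‖ ^ (θ : ℝ))) * japaneseBracket (t - s) := by
          gcongr
          · rw [one_mul]
            exact le_mul_of_one_le_right (by positivity) hjb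
          · exact abs_le_japaneseBracket _
      _ = _ := by ring
  have hroot := Real.rpow_le_rpow (by positivity) hfin (by positivity : (0 : ℝ) ≤ 1 / θ)
  have hθ0 : (θ : ℝ) ≠ 0 := (NNReal.coe_pos.mpr hθ).ne'
  rw [Real.mul_rpow (by positivity) (by positivity), ← Real.rpow_mul (norm_nonneg _),
    ← Real.rpow_mul (norm_nonneg _), mul_one_div_cancel hθ0, Real.rpow_one, Real.rpow_one] at hroot
  exact hroot

end IsBoundedModel

end PositiveOperator

/-! ### Strong convergence of uniformly bounded operators. -/

section StrongConvergence

open Filter Topology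

variable {E : Type*} [NormedAddCommGroup E] [NormedSpace ℂ E]

/-- Uniformly bounded families of operators that are uniformly Cauchy on a dense range are so
on the whole space. -/
theorem uniformCauchySeqOn_of_denseRange {T : ℕ → ℝ → E →L[ℂ] E} {S : Set ℝ} {M : ℝ}
    (hM : ∀ n, ∀ t ∈ S, ‖T n t‖ ≤ M) {X : E → E} (hX : DenseRange X)
    (h : ∀ y, UniformCauchySeqOn (fun n t => T n t (X y)) atTop S) (x : E) :
    UniformCauchySeqOn (fun n t => T n t x) atTop S := by
  rw [Metric.uniformCauchySeqOn_iff]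
  intro ε hε
  obtain ⟨y, hy⟩ := Metric.denseRange_iff.mp hX x (ε / (4 * (|M| + 1))) (by positivity)
  obtain ⟨N, hN⟩ := Metric.uniformCauchySeqOn_iff.mp (h y) (ε / 2) (by positivity)
  refine ⟨N, fun k hk l hl t ht => ?_⟩
  have h1 : ∀ n, dist (T n t x) (T n t (X y)) ≤ ε / 4 := fun n => by
    rw [dist_eq_norm, ← map_sub]
    refine ((T n t).le_opNorm _).trans ?_
    rw [dist_eq_norm] at hy
    have h2 : ‖T n t‖ ≤ |M| + 1 := (hM n t ht).trans ((le_abs_self M).trans (by linarith))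
    calc ‖T n t‖ * ‖x - X y‖ ≤ (|M| + 1) * (ε / (4 * (|M| + 1))) := by gcongr
      _ = ε / 4 := by field_simp
  have h2 := hN k hk l hl t ht
  have h3 := h1 l
  rw [dist_comm] at h3
  calc dist (T k t x) (T l t x) ≤ dist (T k t x) (T k t (X y)) +
        dist (T k t (X y)) (T l t (X y)) + dist (T l t (X y)) (T l t x) := dist_triangle4 _ _ _ _
    _ < ε := by linarith [h1 k]

/-- Uniformly bounded operators that converge strongly may be applied to convergent sequences. -/
theorem tendsto_apply_of_tendsto {T : ℕ → E →L[ℂ] E} {T' : E →L[ℂ] E} {M : ℝ}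
    (hM : ∀ n, ‖T n‖ ≤ M) (hT : ∀ x, Tendsto (fun n => T n x) atTop (𝓝 (T' x)))
    {z : ℕ → E} {z' : E} (hz : Tendsto z atTop (𝓝 z')) :
    Tendsto (fun n => T n (z n)) atTop (𝓝 (T' z')) := by
  have h1 : Tendsto (fun n => T n (z n - z')) atTop (𝓝 0) := by
    refine squeeze_zero_norm (a := fun n => M * ‖z n - z'‖) (fun n => ?_) ?_
    · exact ((T n).le_opNorm _).trans (mul_le_mul_of_nonneg_right (hM n) (norm_nonneg _))
    · have := (tendsto_iff_norm_sub_tendsto_zero.mp hz).const_mul M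
      simpa using this
  have h2 := h1.add (hT z')
  simpa using h2

end StrongConvergence

/-! ### Convergence of the regularized flows. -/

namespace PositiveOperator

open Filter Topology

variable {E : Type*} [NormedAddCommGroup E] [InnerProductSpace ℂ E] [CompleteSpace E]
  {H : PositiveOperator E}

/-- On the range of `H⁻¹` the convergence has rate `ε`; density and the uniform bound `1` give the
rest. -/
theorem tendsto_smoothing (N : ℕ) (x : E) :
    Tendsto (fun n : ℕ => H.smoothing N (1 / ((n : ℝ) + 1)) x) atTop (𝓝 x) := by
  have hpos : ∀ n : ℕ, 0 < 1 / ((n : ℝ) + 1) := fun n => Nat.one_div_pos_of_nat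
  have hc := uniformCauchySeqOn_of_denseRange (S := Set.univ) (M := 1)
    (T := fun n _ => H.smoothing N (1 / ((n : ℝ) + 1)))
    (fun n _ _ => H.norm_smoothing_le N (hpos n)) (X := H.inv)
    (by simpa using H.denseRange_inv_pow 1)
  have key : ∀ y, Tendsto (fun n : ℕ => H.smoothing N (1 / ((n : ℝ) + 1)) (H.inv y)) atTop
      (𝓝 (H.inv y)) := by
    intro y
    rw [tendsto_iff_norm_sub_tendsto_zero]
    refine squeeze_zero (g := fun n : ℕ => 1 / ((n : ℝ) + 1) * ‖y‖) (fun _ => norm_nonneg _)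
      (fun n => ?_) ?_
    · have h1 : H.smoothing N (1 / ((n : ℝ) + 1)) (H.inv y) - H.inv y =
          -(((1 - H.smoothing N (1 / ((n : ℝ) + 1))) * H.inv) y) := by
        simp [sub_apply]
      rw [h1, norm_neg]
      exact (ContinuousLinearMap.le_opNorm _ _).trans (mul_le_mul_of_nonneg_right
        (H.norm_one_sub_smoothing_mul_inv_le N (hpos n)) (norm_nonneg _))
    · simpa using tendsto_one_div_add_atTop_nhds_zero_nat.mul_const ‖y‖
  rw [Metric.tendsto_atTop]
  intro ε hε
  obtain ⟨y, hy⟩ := Metric.denseRange_iff.mp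
    (by simpa using H.denseRange_inv_pow 1 : DenseRange H.inv) x (ε / 3) (by positivity)
  obtain ⟨n₀, hn₀⟩ := Metric.tendsto_atTop.mp (key y) (ε / 3) (by positivity)
  refine ⟨n₀, fun n hn => ?_⟩
  have h1 : dist (H.smoothing N (1 / ((n : ℝ) + 1)) x)
      (H.smoothing N (1 / ((n : ℝ) + 1)) (H.inv y)) ≤ dist x (H.inv y) := by
    rw [dist_eq_norm, dist_eq_norm, ← map_sub]
    exact (ContinuousLinearMap.le_opNorm _ _).trans (mul_le_of_le_one_left (norm_nonneg _)
      (H.norm_smoothing_le N (hpos n)))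
  have h2 := hn₀ n hn
  have h3 := dist_triangle4 (H.smoothing N (1 / ((n : ℝ) + 1)) x)
    (H.smoothing N (1 / ((n : ℝ) + 1)) (H.inv y)) (H.inv y) x
  rw [dist_comm (H.inv y) x] at h3
  linarith

namespace IsBoundedModel

variable {m N K : ℕ} {δ : ℝ≥0} {Λ B : ℝ → E →L[ℂ] E} (hM : H.IsBoundedModel m δ Λ B)

include hM

/-- The regularized generators converge in norm as operators from `𝓗^{2m+2}` to `𝓗^0`. -/
theorem exists_norm_regGen_mul_pow_sub_le (hB : H.BoundedLift B 0) (hN : m ≤ N) :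
    ∃ C : ℝ, 0 ≤ C ∧ ∀ ε, 0 < ε → ∀ t,
      ‖H.regGen Λ m N 0 ε t * H.inv ^ (m + 1) - Λ t * H.inv‖ ≤ C * ε := by
  obtain ⟨S, C, hC0, hC, hS⟩ := hM.exists_mul_pow_eq (K := 1)
    (fun i hi => by rw [Nat.lt_one_iff.mp hi]; exact hB)
  obtain ⟨C', hC'⟩ := hM.bddCont.2
  have hC0' : 0 ≤ C' := (norm_nonneg _).trans (hC' 0)
  refine ⟨C' + (C' + C * ‖H.inv ^ m * H.negPow δ‖), by positivity, fun ε hε t => ?_⟩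
  set R := H.smoothing N ε
  set X := Λ t - S t * (H.inv ^ m * H.negPow δ) with hX
  have hXn : ‖X‖ ≤ C' + C * ‖H.inv ^ m * H.negPow δ‖ := by
    refine (norm_sub_le _ _).trans (add_le_add (hC' t) ((norm_mul_le _ _).trans ?_))
    gcongr
    exact hC t
  have h1 : Λ t * H.inv = H.inv * X := by
    have := hS t
    rw [pow_one] at this
    rw [this, hX, mul_assoc (S t)]
  -- Since `Λ H⁻¹ = H⁻¹ X` with `X` bounded, both occurrences of `1 - R` stand next to a factor
  -- `H⁻¹`, which makes them of size `ε`.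
  have h2 : H.regGen Λ m N 0 ε t * H.inv ^ (m + 1) - Λ t * H.inv =
      -(R * Λ t * ((1 - R) * H.inv)) - ((1 - R) * H.inv) * X := by
    rw [regGen_zero, mul_assoc, regularizer_mul_pow hN, pow_one, mul_assoc ((1 - R)), ← h1]
    change R * Λ t * (R * H.inv) - _ = _
    noncomm_ring
  have hR := H.norm_smoothing_le N hε
  have hR1 := H.norm_one_sub_smoothing_mul_inv_le N hε
  rw [h2]
  calc _ ≤ ‖R‖ * ‖Λ t‖ * ‖(1 - R) * H.inv‖ + ‖(1 - R) * H.inv‖ * ‖X‖ := by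
        refine (norm_sub_le _ _).trans (add_le_add ?_ (norm_mul_le _ _))
        rw [norm_neg]
        exact (norm_mul_le _ _).trans
          (mul_le_mul_of_nonneg_right (norm_mul_le _ _) (norm_nonneg _))
    _ ≤ 1 * C' * ε + ε * (C' + C * ‖H.inv ^ m * H.negPow δ‖) := by
        gcongr
        exact hC' t
    _ = _ := by ring

/-- The regularized flows are uniformly bounded on bounded time intervals. -/
theorem exists_norm_evolution_le_of_abs_le (hδ : 0 < δ) (hK : ∀ i < K, H.BoundedLift B i)
    (T : ℝ) : ∃ M : ℝ, 0 ≤ M ∧ ∀ N ε, m ≤ N → K ≤ N → 0 < ε → ∀ t s, |t - s| ≤ T →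
      ‖evolution (H.regGen Λ m N K ε) t s‖ ≤ M := by
  -- Only local bounds are wanted, so any admissible `θ` will do; `K + 1` in the denominator covers
  -- `K = 0`.
  have hp : 0 < δ / (K + 1) := by positivity
  obtain ⟨C, hC0, hC⟩ := hM.exists_norm_evolution_le hK (θ := min 1 (δ / (K + 1)))
    (lt_min one_pos hp) (min_le_left _ _) (by
      calc min 1 (δ / (K + 1)) * K ≤ δ / (K + 1) * (K + 1) := by
            gcongr
            · exact min_le_right _ _
            · exact le_self_add
        _ = δ := by field_simp)
  refine ⟨(C * japaneseBracket T) ^ (1 / (min 1 (δ / (K + 1)) : ℝ≥0) : ℝ), ?_,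
    fun N ε hm hN hε t s hts => (hC N ε hm hN hε t s).trans ?_⟩
  · have := one_le_japaneseBracket T
    positivity
  · have := one_le_japaneseBracket (t - s)
    refine Real.rpow_le_rpow (by positivity) ?_ (by positivity)
    gcongr
    exact japaneseBracket_mono (hts.trans (le_abs_self T))

/-- The regularized flows form a Cauchy sequence on `𝓗^{2m+2}` in the norm of `𝓗^0`. -/
theorem exists_norm_evolution_sub_le (hδ : 0 < δ) (hB : ∀ i < m + 1, H.BoundedLift B i)
    (hN : m + 1 ≤ N) (T : ℝ) : ∃ C : ℝ, 0 ≤ C ∧ ∀ ε ε', 0 < ε → 0 < ε' → ∀ t s, |t - s| ≤ T →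
      ∀ y, ‖evolution (H.regGen Λ m N 0 ε) t s ((H.inv ^ (m + 1) : E →L[ℂ] E) y) -
        evolution (H.regGen Λ m N 0 ε') t s ((H.inv ^ (m + 1) : E →L[ℂ] E) y)‖ ≤
          C * (ε + ε') * ‖y‖ := by
  have hmN : m ≤ N := (Nat.le_succ m).trans hN
  obtain ⟨M, hM0, hMb⟩ := hM.exists_norm_evolution_le_of_abs_le hδ hB T
  obtain ⟨C, hC0, hC⟩ := hM.exists_norm_regGen_mul_pow_sub_le (hB 0 (Nat.succ_pos m)) hmN
  refine ⟨C * M * |T|, by positivity, fun ε ε' hε hε' t s hts y => ?_⟩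
  have hb : ∀ ε, IsBddCont (H.regGen Λ m N 0 ε) := fun ε => regGen_isBddCont hM.bddCont
  have hb' : IsBddCont (H.regGen Λ m N (m + 1) ε) := regGen_isBddCont hM.bddCont
  set v := fun r => evolution (H.regGen Λ m N (m + 1) ε) r s y with hv
  set φ := fun r => evolution (H.regGen Λ m N 0 ε) r s ((H.inv ^ (m + 1) : E →L[ℂ] E) y) with hφ
  have hcomm : ∀ t, H.inv ^ (m + 1) * H.regGen Λ m N (m + 1) ε t =
      H.regGen Λ m N 0 ε t * H.inv ^ (m + 1) := pow_regGen (Nat.zero_le (m + 1)) hN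
  have hφv : ∀ r, φ r = (H.inv ^ (m + 1) : E →L[ℂ] E) (v r) := fun r =>
    (congrArg (fun A : E →L[ℂ] E => A y) ((hb ε).evolution_intertwine hb' (X := H.inv ^ (m + 1))
      hcomm r s)).symm
  -- The flow for `ε` is an approximate solution for `ε'`. The error is the difference of the
  -- generators on `H^{-(m+1)} v`, and each of them is close to `Λ H⁻¹` there.
  have hder : ∀ r, HasDerivAt φ (-Complex.I • H.regGen Λ m N 0 ε' r (φ r) +
      Complex.I • (H.regGen Λ m N 0 ε' r (φ r) - H.regGen Λ m N 0 ε r (φ r))) r := by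
    intro r
    refine ((hb ε).hasDerivAt_evolution_apply r s _).congr_deriv ?_
    rw [smul_sub]
    simp only [neg_smul]
    abel
  have hle := (hb ε').norm_sub_evolution_le
    (fun t => hM.regGen_zero_isSelfAdjoint (ε := ε') hmN t) hder (s := s) (t := t)
    (η := C * (ε + ε') * (M * ‖y‖)) (fun r hr => by
      have hrs : |r - s| ≤ T := by
        refine le_trans ?_ hts
        rcases Set.mem_uIcc.mp hr with h | h
        · rw [abs_of_nonneg (by linarith [h.1]), abs_of_nonneg (by linarith [h.1, h.2])]
          linarith [h.2]
        · rw [abs_of_nonpos (by linarith [h.2]), abs_of_nonpos (by linarith [h.1, h.2])]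
          linarith [h.1]
      have hvr : ‖v r‖ ≤ M * ‖y‖ := (ContinuousLinearMap.le_opNorm _ _).trans
        (mul_le_mul_of_nonneg_right (hMb N ε hmN hN hε r s hrs) (norm_nonneg _))
      have h1 : H.regGen Λ m N 0 ε' r (φ r) - H.regGen Λ m N 0 ε r (φ r) =
          (H.regGen Λ m N 0 ε' r * H.inv ^ (m + 1) - Λ r * H.inv) (v r) -
          (H.regGen Λ m N 0 ε r * H.inv ^ (m + 1) - Λ r * H.inv) (v r) := by
        rw [hφv]
        simp only [sub_apply]
        rw [sub_sub_sub_cancel_right]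
        rfl
      rw [norm_smul, Complex.norm_I, one_mul, h1]
      calc _ ≤ C * ε' * ‖v r‖ + C * ε * ‖v r‖ := by
            refine (norm_sub_le _ _).trans (add_le_add ?_ ?_) <;>
            refine (ContinuousLinearMap.le_opNorm _ _).trans ?_
            · exact mul_le_mul_of_nonneg_right (hC ε' hε' r) (norm_nonneg _)
            · exact mul_le_mul_of_nonneg_right (hC ε hε r) (norm_nonneg _)
        _ = C * (ε + ε') * ‖v r‖ := by ring
        _ ≤ _ := by gcongr)
  have hs : φ s = (H.inv ^ (m + 1) : E →L[ℂ] E) y := by simp [hφ, (hb ε).evolution_self]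
  rw [hs] at hle
  refine hle.trans ?_
  calc C * (ε + ε') * (M * ‖y‖) * |t - s| ≤ C * (ε + ε') * (M * ‖y‖) * |T| :=
        mul_le_mul_of_nonneg_left (hts.trans (le_abs_self T)) (by positivity)
    _ = _ := by ring

/-- For data in `𝓗^{2m+2}` the flows are Cauchy in `𝓗^0` and bounded in `𝓗^{2m+2}`, hence by
interpolation Cauchy in `𝓗^{2K}` for `K ≤ m`. Density and the uniform bound on `𝓗^{2K}` extend this
to all data there. -/
theorem uniformCauchySeqOn_evolution (hδ : 0 < δ) (hB : ∀ i < m + 1, H.BoundedLift B i)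
    (hN : m + 1 ≤ N) (hK : K ≤ m) (T s : ℝ) (x : E) :
    UniformCauchySeqOn (fun (n : ℕ) t => evolution (H.regGen Λ m N K (1 / ((n : ℝ) + 1))) t s x)
      atTop {t | |t - s| ≤ T} := by
  have hpos : ∀ n : ℕ, 0 < 1 / ((n : ℝ) + 1) := fun n => Nat.one_div_pos_of_nat
  have hmN : m ≤ N := (Nat.le_succ m).trans hN
  obtain ⟨MK, -, hMK⟩ := hM.exists_norm_evolution_le_of_abs_le (K := K) hδ
    (fun i hi => hB i (by omega)) T
  obtain ⟨M, hM0, hMb⟩ := hM.exists_norm_evolution_le_of_abs_le hδ hB T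
  obtain ⟨C, hC0, hC⟩ := hM.exists_norm_evolution_sub_le hδ hB hN T
  refine uniformCauchySeqOn_of_denseRange (S := {t | |t - s| ≤ T}) (M := MK)
    (fun n t ht => hMK N _ hmN (by omega) (hpos n) t s ht)
    (H.denseRange_inv_pow (m + 1 - K)) (fun y => ?_) x
  have hb : ∀ K ε, IsBddCont (H.regGen Λ m N K ε) := fun K ε => regGen_isBddCont hM.bddCont
  -- The weight of the small `𝓗^0` norm in the interpolation, positive because `K ≤ m`; this is why
  -- one order beyond `m` is controlled.
  set θ : ℝ≥0 := (m + 1 - K : ℕ) / (m + 1 : ℕ) with hθ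
  have hθ1 : θ ≤ 1 := by
    rw [hθ]
    refine div_le_one_of_le₀ ?_ (by positivity)
    exact_mod_cast Nat.sub_le _ _
  have hθ0 : 0 < θ := by
    have : 0 < m + 1 - K := by omega
    rw [hθ]
    positivity
  have hθm : θ * (m + 1 : ℕ) = (m + 1 - K : ℕ) := by
    rw [hθ]
    exact div_mul_cancel₀ _ (by positivity)
  have hdiff : ∀ n n' : ℕ, ∀ t, |t - s| ≤ T →
      ‖evolution (H.regGen Λ m N K (1 / ((n : ℝ) + 1))) t s ((H.inv ^ (m + 1 - K) : E →L[ℂ] E) y) -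
        evolution (H.regGen Λ m N K (1 / ((n' : ℝ) + 1))) t s
          ((H.inv ^ (m + 1 - K) : E →L[ℂ] E) y)‖ ≤
        (2 * M * ‖y‖) ^ (1 - θ : ℝ) *
          (C * (1 / ((n : ℝ) + 1) + 1 / ((n' : ℝ) + 1)) * ‖y‖) ^ (θ : ℝ) := by
    intro n n' t ht
    set v := fun n : ℕ => evolution (H.regGen Λ m N (m + 1) (1 / ((n : ℝ) + 1))) t s y
    have hinter : ∀ (J : ℕ) (hJ : J ≤ m + 1) (n : ℕ),
        evolution (H.regGen Λ m N J (1 / ((n : ℝ) + 1))) t s ((H.inv ^ (m + 1 - J) : E →L[ℂ] E) y)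
          = (H.inv ^ (m + 1 - J) : E →L[ℂ] E) (v n) := fun J hJ n =>
      (congrArg (fun A : E →L[ℂ] E => A y) ((hb J _).evolution_intertwine (hb (m + 1) _)
        (X := H.inv ^ (m + 1 - J)) (fun t => pow_regGen hJ hN t) t s)).symm
    rw [hinter K (by omega), hinter K (by omega), ← map_sub]
    have h1 := H.norm_negPow_interpolation (m + 1 : ℕ) θ hθ1 (v n - v n')
    rw [hθm, negPow_natCast, negPow_natCast] at h1
    refine h1.trans ?_
    have h2 : ‖v n - v n'‖ ≤ 2 * M * ‖y‖ := by
      have h3 : ∀ n, ‖v n‖ ≤ M * ‖y‖ := fun n => (ContinuousLinearMap.le_opNorm _ _).trans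
        (mul_le_mul_of_nonneg_right (hMb N _ hmN hN (hpos n) t s ht) (norm_nonneg _))
      linarith [norm_sub_le (v n) (v n'), h3 n, h3 n']
    have h4 : ‖(H.inv ^ (m + 1) : E →L[ℂ] E) (v n - v n')‖ ≤
        C * (1 / ((n : ℝ) + 1) + 1 / ((n' : ℝ) + 1)) * ‖y‖ := by
      have h5 := hC _ _ (hpos n) (hpos n') t s ht y
      have h6 := hinter 0 (Nat.zero_le _)
      simp only [Nat.sub_zero] at h6
      rwa [h6, h6, ← map_sub] at h5
    have hθ1' : (0 : ℝ) ≤ 1 - θ := sub_nonneg.mpr hθ1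
    gcongr
  rw [Metric.uniformCauchySeqOn_iff]
  intro η hη
  have hlim : Tendsto (fun a : ℝ => (2 * M * ‖y‖) ^ (1 - θ : ℝ) * (C * (a + a) * ‖y‖) ^ (θ : ℝ))
      (𝓝 0) (𝓝 0) := by
    have hc : Continuous fun a : ℝ =>
        (2 * M * ‖y‖) ^ (1 - θ : ℝ) * (C * (a + a) * ‖y‖) ^ (θ : ℝ) :=
      continuous_const.mul ((by fun_prop : Continuous fun a : ℝ => C * (a + a) * ‖y‖).rpow_const
        fun _ => Or.inr θ.2)
    have := hc.tendsto 0
    simpa [Real.zero_rpow (NNReal.coe_pos.mpr hθ0).ne'] using this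
  have hlim' := hlim.comp tendsto_one_div_add_atTop_nhds_zero_nat
  obtain ⟨n₀, hn₀⟩ := (hlim'.eventually (gt_mem_nhds hη)).exists
  refine ⟨n₀, fun n hn n' hn' t ht => ?_⟩
  rw [dist_eq_norm]
  refine (hdiff n n' t ht).trans_lt (lt_of_le_of_lt ?_ hn₀)
  have hle : ∀ n : ℕ, n₀ ≤ n → 1 / ((n : ℝ) + 1) ≤ 1 / ((n₀ : ℝ) + 1) := fun n hn => by
    gcongr
  dsimp only [Function.comp]
  have h1 := hle n hn
  have h2 := hle n' hn'
  gcongr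

/-- Strong limits of the regularized flows, locally uniformly in time. -/
theorem exists_tendsto_evolution (hδ : 0 < δ) (hB : ∀ i < m + 1, H.BoundedLift B i)
    (hN : m + 1 ≤ N) (hK : K ≤ m) : ∃ V : ℝ → ℝ → E →L[ℂ] E,
      (∀ t s x, Tendsto (fun n : ℕ => evolution (H.regGen Λ m N K (1 / ((n : ℝ) + 1))) t s x)
        atTop (𝓝 (V t s x))) ∧ ∀ s x, Continuous fun t => V t s x := by
  have hlim : ∀ t s x, ∃ z, Tendsto
      (fun n : ℕ => evolution (H.regGen Λ m N K (1 / ((n : ℝ) + 1))) t s x) atTop (𝓝 z) :=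
    fun t s x => cauchySeq_tendsto_of_complete
      ((hM.uniformCauchySeqOn_evolution hδ hB hN hK |t - s| s x).cauchySeq (x := t)
        (Set.mem_ofPred_eq ▸ le_refl |t - s|))
  choose z hz using hlim
  have hz' : ∀ t s, Tendsto (fun (n : ℕ) x =>
      evolution (H.regGen Λ m N K (1 / ((n : ℝ) + 1))) t s x) atTop (𝓝 (z t s)) :=
    fun t s => tendsto_pi_nhds.mpr (hz t s)
  refine ⟨fun t s => continuousLinearMapOfTendsto _ (hz' t s), hz, fun s x => ?_⟩
  have hloc : TendstoLocallyUniformly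
      (fun (n : ℕ) t => evolution (H.regGen Λ m N K (1 / ((n : ℝ) + 1))) t s x)
      (fun t => z t s x) atTop := by
    rw [← tendstoLocallyUniformlyOn_univ]
    refine tendstoLocallyUniformlyOn_of_forall_exists_nhds fun t _ =>
      ⟨{r | |r - s| ≤ |t - s| + 1}, ?_, ?_⟩
    · rw [nhdsWithin_univ]
      have hc : Continuous fun r : ℝ => |r - s| := by fun_prop
      filter_upwards [hc.continuousAt.eventually (gt_mem_nhds (lt_add_one |t - s|))] with r hr
      exact hr.le
    · exact (hM.uniformCauchySeqOn_evolution hδ hB hN hK _ s x).tendstoUniformlyOn_of_tendsto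
        fun r _ => hz r s x
  refine hloc.continuous (Frequently.of_forall fun n => ?_)
  exact continuous_iff_continuousAt.mpr fun t => ((regGen_isBddCont
    hM.bddCont).hasDerivAt_evolution_apply t s x).continuousAt

end IsBoundedModel

end PositiveOperator

/-! ### The limit flow. -/

namespace PositiveOperator

open Filter Topology

variable {E : Type*} [NormedAddCommGroup E] [InnerProductSpace ℂ E] [CompleteSpace E]

/-- A unitary flow `U` on `𝓗^0` which restricts to a strongly continuous flow on `𝓗^{2m}`,
given by `H^{-m} V = U H^{-m}`, and solves `i ∂_t U = L(t) U` there. -/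
structure IsModelFlow (H : PositiveOperator E) (m : ℕ) (Λ : ℝ → E →L[ℂ] E)
    (U V : ℝ → ℝ → E →L[ℂ] E) : Prop where
  star_eq : ∀ t s, star (U t s) = U s t
  mul_eq_one : ∀ t s, U t s * U s t = 1
  intertwine : ∀ t s, H.inv ^ m * V t s = U t s * H.inv ^ m
  self_eq_one : ∀ s, V s s = 1
  continuous : ∀ s x, Continuous fun t => V t s x
  hasDerivAt : ∀ t s x, HasDerivAt (fun t => U t s ((H.inv ^ m : E →L[ℂ] E) x))
    (-Complex.I • Λ t (V t s x)) t

variable {H : PositiveOperator E}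

variable {m N K : ℕ} {δ : ℝ≥0} {Λ B : ℝ → E →L[ℂ] E}

theorem pow_mul_evolution {J : ℕ} (hΛ : IsBddCont Λ) (hJ : J ≤ N) (ε t s : ℝ) :
    H.inv ^ J * evolution (H.regGen Λ m N J ε) t s =
      evolution (H.regGen Λ m N 0 ε) t s * H.inv ^ J :=
  (regGen_isBddCont hΛ).evolution_intertwine (regGen_isBddCont hΛ)
    (pow_regGen (Nat.zero_le J) hJ) t s

namespace IsBoundedModel

variable (hM : H.IsBoundedModel m δ Λ B)

include hM

/-- The strong limit of the regularized flows solves the limit equation. -/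
theorem hasDerivAt_of_tendsto (hδ : 0 < δ) (hB : ∀ i < m, H.BoundedLift B i) (hmN : m ≤ N)
    {U V : ℝ → ℝ → E →L[ℂ] E}
    (hU : ∀ t s x, Tendsto (fun n : ℕ =>
      evolution (H.regGen Λ m N 0 (1 / ((n : ℝ) + 1))) t s x) atTop (𝓝 (U t s x)))
    (hV : ∀ t s x, Tendsto (fun n : ℕ =>
      evolution (H.regGen Λ m N m (1 / ((n : ℝ) + 1))) t s x) atTop (𝓝 (V t s x)))
    (hVc : ∀ s x, Continuous fun t => V t s x) (t s : ℝ) (x : E) :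
    HasDerivAt (fun t => U t s ((H.inv ^ m : E →L[ℂ] E) x)) (-Complex.I • Λ t (V t s x)) t := by
  have hpos : ∀ n : ℕ, 0 < 1 / ((n : ℝ) + 1) := fun n => Nat.one_div_pos_of_nat
  have hb : ∀ K ε, IsBddCont (H.regGen Λ m N K ε) := fun K ε => regGen_isBddCont hM.bddCont
  set f : ℝ → E := fun r => -Complex.I • Λ r (V r s x) with hf
  have hfc : Continuous f := (hM.bddCont.1.clm_apply (hVc s x)).const_smul _
  -- The derivatives converge only strongly, so the limit is taken in the integrated equation by
  -- dominated convergence.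
  have hint : ∀ t, U t s ((H.inv ^ m : E →L[ℂ] E) x) =
      (H.inv ^ m : E →L[ℂ] E) x + ∫ r in s..t, f r := by
    intro t
    obtain ⟨M, hM0, hMb⟩ := hM.exists_norm_evolution_le_of_abs_le (K := m) hδ hB |t - s|
    obtain ⟨C, hC⟩ := hM.bddCont.2
    have hC0 : 0 ≤ C := (norm_nonneg _).trans (hC 0)
    set F : ℕ → ℝ → E := fun n r => -Complex.I • H.smoothing N (1 / ((n : ℝ) + 1))
      (Λ r (H.smoothing N (1 / ((n : ℝ) + 1))
        (evolution (H.regGen Λ m N m (1 / ((n : ℝ) + 1))) r s x))) with hF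
    have hder : ∀ (n : ℕ) r, HasDerivAt (fun r => evolution (H.regGen Λ m N 0 (1 / ((n : ℝ) + 1))) r s
        ((H.inv ^ m : E →L[ℂ] E) x)) (F n r) r := by
      intro n r
      refine ((hb 0 _).hasDerivAt_evolution_apply r s _).congr_deriv ?_
      have h1 := congrArg (fun A : E →L[ℂ] E => A x) (pow_mul_evolution (H := H) (m := m) hM.bddCont hmN (1 / ((n : ℝ) + 1)) r s)
      have h2 : evolution (H.regGen Λ m N 0 (1 / ((n : ℝ) + 1))) r s
          ((H.inv ^ m : E →L[ℂ] E) x) = (H.inv ^ m : E →L[ℂ] E)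
            (evolution (H.regGen Λ m N m (1 / ((n : ℝ) + 1))) r s x) := h1.symm
      have h3 := regularizer_mul_pow (H := H) (ε := 1 / ((n : ℝ) + 1)) (i := 0) hmN
      rw [add_zero, pow_zero, mul_one] at h3
      have h4 : H.regGen Λ m N 0 (1 / ((n : ℝ) + 1)) r * H.inv ^ m =
          H.smoothing N (1 / ((n : ℝ) + 1)) * Λ r * H.smoothing N (1 / ((n : ℝ) + 1)) := by
        rw [regGen_zero, mul_assoc, h3]
      rw [h2, ← mul_apply_eq_comp (H.regGen Λ m N 0 _ r), h4]
      rfl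
    have hVn : ∀ n : ℕ, Continuous fun r =>
        evolution (H.regGen Λ m N m (1 / ((n : ℝ) + 1))) r s x := fun n =>
      continuous_iff_continuousAt.mpr fun r =>
        ((hb m _).hasDerivAt_evolution_apply r s x).continuousAt
    have hFc : ∀ n : ℕ, Continuous (F n) := fun n =>
      (((H.smoothing N _).continuous.comp (hM.bddCont.1.clm_apply
        ((H.smoothing N _).continuous.comp (hVn n))))).const_smul _
    have hFi : ∀ n : ℕ, evolution (H.regGen Λ m N 0 (1 / ((n : ℝ) + 1))) t s
        ((H.inv ^ m : E →L[ℂ] E) x) = (H.inv ^ m : E →L[ℂ] E) x + ∫ r in s..t, F n r := by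
      intro n
      rw [intervalIntegral.integral_eq_sub_of_hasDerivAt (fun r _ => hder n r)
        ((hFc n).intervalIntegrable _ _), (hb 0 _).evolution_self]
      simp
    have hsm : ∀ (n : ℕ) (y : E), ‖H.smoothing N (1 / ((n : ℝ) + 1)) y‖ ≤ ‖y‖ := fun n y =>
      (ContinuousLinearMap.le_opNorm _ _).trans
        (mul_le_of_le_one_left (norm_nonneg _) (H.norm_smoothing_le N (hpos n)))
    have hlim : Tendsto (fun n => ∫ r in s..t, F n r) atTop (𝓝 (∫ r in s..t, f r)) := by
      refine intervalIntegral.tendsto_integral_filter_of_dominated_convergence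
        (fun _ => C * (M * ‖x‖)) (Eventually.of_forall fun n => (hFc n).aestronglyMeasurable)
        (Eventually.of_forall fun n => Eventually.of_forall fun r hr => ?_)
        intervalIntegrable_const (Eventually.of_forall fun r _ => ?_)
      · have hrs : |r - s| ≤ |t - s| := by
          have := Set.abs_sub_left_of_mem_uIcc (Set.uIoc_subset_uIcc hr)
          exact this
        rw [hF, norm_smul, norm_neg, Complex.norm_I, one_mul]
        refine (hsm n _).trans (((Λ r).le_opNorm _).trans ?_)
        gcongr
        · exact hC r
        · refine (hsm n _).trans ((ContinuousLinearMap.le_opNorm _ _).trans ?_)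
          gcongr
          exact hMb N _ hmN hmN (hpos n) r s hrs
      · have hs1 := tendsto_apply_of_tendsto (T' := 1)
          (fun n => H.norm_smoothing_le N (hpos n)) (fun y => H.tendsto_smoothing N y) (hV r s x)
        have hs2 := tendsto_apply_of_tendsto (T' := 1)
          (fun n => H.norm_smoothing_le N (hpos n)) (fun y => H.tendsto_smoothing N y)
          (((Λ r).continuous.tendsto _).comp hs1)
        exact hs2.const_smul (-Complex.I)
    exact tendsto_nhds_unique (hU t s _)
      ((hlim.const_add _).congr fun n => (hFi n).symm)
  have h1 := (intervalIntegral.integral_hasDerivAt_right (hfc.intervalIntegrable s t)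
    (hfc.stronglyMeasurableAtFilter _ _) hfc.continuousAt).const_add
      ((H.inv ^ m : E →L[ℂ] E) x)
  exact h1.congr_of_eventuallyEq (Eventually.of_forall hint)

/-- The flow of the limit equation, with a bound of the dual norm. -/
theorem exists_isModelFlow (hδ : 0 < δ) (hB : ∀ i < m + 1, H.BoundedLift B i) (K : ℕ)
    (hK : ∀ i < K, H.BoundedLift B i) {θ : ℝ≥0} (hθ : 0 < θ) (hθ1 : θ ≤ 1) (hθK : θ * K ≤ δ) :
    ∃ U V, H.IsModelFlow m Λ U V ∧ ∃ C : ℝ, 0 < C ∧ ∀ t s x,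
      ‖(H.inv ^ K : E →L[ℂ] E) (U s t x)‖ ≤
        (C * japaneseBracket (t - s)) ^ (1 / θ : ℝ) * ‖(H.inv ^ K : E →L[ℂ] E) x‖ := by
  -- One smoothing order serves both the convergence and the growth bound.
  set N := max (m + 1) K with hN_def
  have hN : m + 1 ≤ N := le_max_left _ _
  have hmN : m ≤ N := (Nat.le_succ m).trans hN
  have hKN : K ≤ N := le_max_right _ _
  have hpos : ∀ n : ℕ, 0 < 1 / ((n : ℝ) + 1) := fun n => Nat.one_div_pos_of_nat
  have hb : ∀ K ε, IsBddCont (H.regGen Λ m N K ε) := fun K ε => regGen_isBddCont hM.bddCont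
  have hsa : ∀ ε t, IsSelfAdjoint (H.regGen Λ m N 0 ε t) := fun ε t =>
    hM.regGen_zero_isSelfAdjoint hmN t
  obtain ⟨U, hU, -⟩ := hM.exists_tendsto_evolution hδ hB hN (Nat.zero_le m)
  obtain ⟨V, hV, hVc⟩ := hM.exists_tendsto_evolution hδ hB hN (le_refl m)
  have hUnorm : ∀ ε t s, ‖evolution (H.regGen Λ m N 0 ε) t s‖ ≤ 1 := fun ε t s =>
    ContinuousLinearMap.opNorm_le_bound _ zero_le_one fun x => by
      rw [(hb 0 ε).norm_evolution_apply (hsa ε), one_mul]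
  have hUV : ∀ t s, H.inv ^ m * V t s = U t s * H.inv ^ m := by
    intro t s
    ext x
    refine tendsto_nhds_unique (((H.inv ^ m : E →L[ℂ] E).continuous.tendsto _).comp (hV t s x)) ?_
    refine (hU t s ((H.inv ^ m : E →L[ℂ] E) x)).congr fun n => ?_
    exact (congrArg (fun A : E →L[ℂ] E => A x) (pow_mul_evolution (H := H) (m := m) hM.bddCont hmN (1 / ((n : ℝ) + 1)) t s)).symm
  refine ⟨U, V, ⟨fun t s => ?_, fun t s => ?_, hUV, fun s => ?_, hVc, fun t s x => ?_⟩, ?_⟩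
  · refine ((ContinuousLinearMap.eq_adjoint_iff (U s t) (U t s)).mpr fun x y => ?_).symm
    refine tendsto_nhds_unique ((hU s t x).inner tendsto_const_nhds)
      (((tendsto_const_nhds (x := x)).inner (hU t s y)).congr fun n => ?_)
    rw [← (hb 0 _).star_evolution (hsa _) t s]
    exact (ContinuousLinearMap.adjoint_inner_left _ _ _).symm
  · ext x
    have h1 := tendsto_apply_of_tendsto (fun n => hUnorm (1 / ((n : ℝ) + 1)) t s)
      (hU t s) (hU s t x)
    refine tendsto_nhds_unique h1 ((tendsto_const_nhds (x := x)).congr fun n => ?_)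
    rw [← mul_apply_eq_comp, (hb 0 _).evolution_mul, (hb 0 _).evolution_self]
    rfl
  · ext x
    refine tendsto_nhds_unique (hV s s x) ((tendsto_const_nhds (x := x)).congr fun n => ?_)
    rw [(hb m _).evolution_self]
    rfl
  · exact hM.hasDerivAt_of_tendsto hδ (fun i hi => hB i (by omega)) hmN hU hV hVc t s x
  -- Adjoints turn the bound of the flow conjugated by `H^K` into a bound of `H^{-K} U(s,t)`. As
  -- `H^{-K}` is bounded, this passes to the strong limit of the unconjugated flows, even for `K >
  -- m`, without a limit of the conjugated ones.
  · obtain ⟨C, hC0, hC⟩ := hM.exists_norm_evolution_le hK hθ hθ1 hθK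
    refine ⟨C, hC0, fun t s x => ?_⟩
    refine le_of_tendsto (((H.inv ^ K : E →L[ℂ] E).continuous.tendsto _).comp (hU s t x)).norm
      (Eventually.of_forall fun n => ?_)
    have h1 := congrArg star (pow_mul_evolution (H := H) (m := m) hM.bddCont hKN (1 / ((n : ℝ) + 1)) t s)
    rw [star_mul, star_mul, star_pow, H.inv_isSelfAdjoint.star_eq,
      (hb 0 _).star_evolution (hsa _)] at h1
    have h2 : (H.inv ^ K : E →L[ℂ] E) (evolution (H.regGen Λ m N 0 (1 / ((n : ℝ) + 1))) s t x) =
        star (evolution (H.regGen Λ m N K (1 / ((n : ℝ) + 1))) t s)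
          ((H.inv ^ K : E →L[ℂ] E) x) := congrArg (fun A : E →L[ℂ] E => A x) h1.symm
    dsimp only [Function.comp]
    rw [h2]
    refine (ContinuousLinearMap.le_opNorm _ _).trans ?_
    rw [norm_star]
    gcongr
    exact hC N _ hmN hKN (hpos n) t s

end IsBoundedModel

/-- Interpolation of the bound of the dual norm. -/
theorem IsModelFlow.exists_mul_negPow_eq {m : ℕ} {Λ : ℝ → E →L[ℂ] E} {U V : ℝ → ℝ → E →L[ℂ] E}
    (h : H.IsModelFlow m Λ U V) {K : ℕ} {M : ℝ} (hM : 0 ≤ M) {t s : ℝ}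
    (hU : ∀ x, ‖(H.inv ^ K : E →L[ℂ] E) (U s t x)‖ ≤ M * ‖(H.inv ^ K : E →L[ℂ] E) x‖)
    {η : ℝ≥0} (hη : η ≤ 1) :
    ∃ Z : E →L[ℂ] E, ‖Z‖ ≤ M ^ (η : ℝ) ∧ U t s * H.negPow (η * K) = H.negPow (η * K) * Z := by
  refine H.exists_mul_negPow_eq (by positivity) fun x => ?_
  rw [h.star_eq]
  lift M to ℝ≥0 using hM
  refine H.norm_negPow_apply_le_rpow ?_ ?_ hη (fun x => ?_) x
  · rw [h.star_eq]; exact h.mul_eq_one t s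
  · rw [h.star_eq]; exact h.mul_eq_one s t
  · simpa only [negPow_natCast] using hU x

end PositiveOperator

/-! ### Translation between the scale of spaces and the bounded model. -/

namespace PositiveOperator

variable {E : Type*} [NormedAddCommGroup E] [InnerProductSpace ℂ E] [CompleteSpace E]
  (H : PositiveOperator E)

theorem toNNReal_half (k : ℝ≥0) : ((k : ℝ) / 2).toNNReal = k / 2 := by
  rw [← NNReal.coe_ofNat, ← NNReal.coe_div, Real.toNNReal_coe]

/-- `H^τ H^{-q} = H^{-(q-τ)}`. -/
theorem rpow_apply_negPow {τ : ℝ} {q q' : ℝ≥0} (hq : (q : ℝ) = q' + τ) (x : E)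
    (h : H.negPow q x ∈ (H.rpow τ).domain) : H.rpow τ ⟨H.negPow q x, h⟩ = H.negPow q' x := by
  have hle : τ.toNNReal ≤ q := by
    rw [Real.toNNReal_le_iff_le_coe, hq]
    linarith [q'.2]
  -- Only the positive part of `τ` is inverted by `H^τ`; its negative part contributes a further
  -- bounded power of `H⁻¹`.
  set y := H.negPow (q - τ.toNNReal) x with hy
  have hx : H.negPow q x = H.negPow τ.toNNReal y := by
    rw [hy, ← mul_apply_eq_comp, ← negPow_add, add_tsub_cancel_of_le hle]
  have h1 : (⟨H.negPow q x, h⟩ : (H.rpow τ).domain) =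
      ⟨H.negPow τ.toNNReal y, ⟨y, rfl⟩⟩ := Subtype.ext hx
  rw [h1]
  have h2 : H.rpow τ ⟨H.negPow τ.toNNReal y, ⟨y, rfl⟩⟩ = H.negPow (-τ).toNNReal y :=
    congrArg (H.negPow (-τ).toNNReal) (LinearEquiv.symm_apply_apply (LinearEquiv.ofInjective
      (H.negPow τ.toNNReal).toLinearMap (H.negPow_injective _)) y)
  rw [h2, hy, ← mul_apply_eq_comp, ← negPow_add]
  congr 2
  rw [← NNReal.coe_inj, NNReal.coe_add, NNReal.coe_sub hle, hq]
  have h3 : ((-τ).toNNReal : ℝ) = (τ.toNNReal : ℝ) - τ := by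
    rcases le_total 0 τ with h0 | h0
    · rw [Real.toNNReal_of_nonpos (neg_nonpos.mpr h0), Real.coe_toNNReal _ h0]; simp
    · rw [Real.toNNReal_of_nonpos h0, Real.coe_toNNReal _ (neg_nonneg.mpr h0)]; simp
  rw [h3]
  ring

/-- The isometry `H^{-k/2} : 𝓗^0 → 𝓗^k`. -/
noncomputable def sobEquiv (k : ℝ≥0) : E ≃ₗᵢ[ℂ] H.Sob k :=
  LinearIsometryEquiv.mk
    (LinearEquiv.ofInjective (H.negPow ((k : ℝ) / 2).toNNReal).toLinearMap
      (H.negPow_injective ((k : ℝ) / 2).toNNReal) : E ≃ₗ[ℂ] (H.rpow ((k : ℝ) / 2)).domain)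
    fun x => congrArg norm ((H.rpow_apply_negPow (τ := (k : ℝ) / 2)
      (q := ((k : ℝ) / 2).toNNReal) (q' := 0) (by
        rw [Real.coe_toNNReal _ (by positivity), NNReal.coe_zero, zero_add]) x ⟨x, rfl⟩).trans
        (by rw [negPow_zero]; rfl))

theorem coe_sobEquiv (k : ℝ≥0) (x : E) : ((H.sobEquiv k x : H.Sob k) : E) = H.negPow (k / 2) x := by
  rw [← toNNReal_half]
  rfl

theorem coe_sobEquiv_two_mul (n : ℕ) (x : E) :
    ((H.sobEquiv (2 * n) x : H.Sob (2 * n)) : E) = (H.inv ^ n : E →L[ℂ] E) x := by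
  rw [coe_sobEquiv, mul_div_cancel_left₀ _ two_ne_zero, negPow_natCast]

variable {H} {m k₀ : ℕ} {L : ℝ → H.Sob (2 * m) →ₗ[ℂ] E}

/-- The isometries `H^{-a/2}` and `H^{-b/2}` transport the operator to `G = H^{b/2} T H^{-a/2}` on
`E`. -/
theorem MemCb.exists_isBddCont {a b : ℝ≥0} {T : ℝ → H.Sob a → E} (h : H.MemCb (b := b) T) :
    ∃ G : ℝ → E →L[ℂ] E, IsBddCont G ∧
      ∀ t x, H.negPow (b / 2) (G t x) = T t (H.sobEquiv a x) := by
  obtain ⟨F, hF⟩ := h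
  let J : E →L[ℂ] H.Sob a := (H.sobEquiv a).toContinuousLinearEquiv
  let J' : H.Sob b →L[ℂ] E := (H.sobEquiv b).symm.toContinuousLinearEquiv
  refine ⟨fun t => (J'.comp (F t)).comp J, ⟨?_, ‖J'‖ * ‖F‖ * ‖J‖, fun t => ?_⟩, fun t x => ?_⟩
  · have := F.continuous
    fun_prop
  · refine (ContinuousLinearMap.opNorm_comp_le _ _).trans ?_
    gcongr
    refine (ContinuousLinearMap.opNorm_comp_le _ _).trans ?_
    gcongr
    exact F.norm_coe_le_norm t
  · rw [← hF, ← coe_sobEquiv]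
    congr 1
    exact (H.sobEquiv b).apply_symm_apply _

variable (L) in
/-- `Λ(t) = L(t) H^{-m}`. -/
def IsReduced (Λ : ℝ → E →L[ℂ] E) : Prop :=
  ∀ t x (ψ : H.Sob (2 * m)), (ψ : E) = (H.inv ^ m : E →L[ℂ] E) x → L t ψ = Λ t x

theorem BoundedOnScale.exists_isReduced (hL : H.BoundedOnScale m k₀ L) :
    ∃ Λ : ℝ → E →L[ℂ] E, IsBddCont Λ ∧ IsReduced L Λ := by
  obtain ⟨Λ, hΛ, h⟩ := (hL 0 (by positivity)).exists_isBddCont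
  refine ⟨Λ, hΛ, fun t x ψ hψ => ?_⟩
  have h1 := h t x
  rw [zero_div, negPow_zero] at h1
  refine Eq.trans ?_ h1.symm
  congr 1
  refine Subtype.ext (hψ.trans ?_)
  have h2 := H.coe_sobEquiv (0 + 2 * m) x
  rw [show ((0 : ℝ≥0) + 2 * m) / 2 = m by rw [zero_add, mul_div_cancel_left₀ _ two_ne_zero],
    negPow_natCast] at h2
  exact h2.symm

/-- Writing `ψ = H^{-m} Q x`, the hypothesis is symmetry of the bounded operator `H^{-m} Λ` on the
dense range of `Q = H^{-k₀/2}`; continuity extends it. -/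
theorem SymmetricOnScale.isSelfAdjoint_of_isReduced (hs : H.SymmetricOnScale m k₀ L)
    {Λ : ℝ → E →L[ℂ] E} (hΛ : IsReduced L Λ) (t : ℝ) : IsSelfAdjoint (H.inv ^ m * Λ t) := by
  set Q := H.negPow ((k₀ : ℝ≥0) / 2) with hQ
  have hcoe : ∀ x, ((H.sobEquiv (k₀ + 2 * m) x : H.Sob (k₀ + 2 * m)) : E) =
      (H.inv ^ m : E →L[ℂ] E) (Q x) := by
    intro x
    rw [coe_sobEquiv, ← negPow_natCast, hQ, ← mul_apply_eq_comp, ← negPow_add]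
    congr 2
    rw [add_div, mul_div_cancel_left₀ _ two_ne_zero, add_comm]
  have hm : IsSelfAdjoint (H.inv ^ m : E →L[ℂ] E) := H.inv_isSelfAdjoint.pow m
  have key : ∀ x y, ⟪(H.inv ^ m * Λ t) (Q x), Q y⟫_ℂ = ⟪Q x, (H.inv ^ m * Λ t) (Q y)⟫_ℂ := by
    intro x y
    have h := hs t (H.sobEquiv _ x) (H.sobEquiv _ y)
    rw [hΛ t (Q x) (Sob.incl le_add_self (H.sobEquiv _ x)) (hcoe x),
      hΛ t (Q y) (Sob.incl le_add_self (H.sobEquiv _ y)) (hcoe y), hcoe, hcoe] at h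
    rw [mul_apply_eq_comp, mul_apply_eq_comp, inner_apply_of_isSelfAdjoint hm, h,
      inner_apply_of_isSelfAdjoint hm]
  have hd : DenseRange Q := H.denseRange_negPow _
  have hall : ∀ x y, ⟪(H.inv ^ m * Λ t) x, y⟫_ℂ = ⟪x, (H.inv ^ m * Λ t) y⟫_ℂ := fun x y =>
    isClosed_property2 hd (p := fun x y => ⟪(H.inv ^ m * Λ t) x, y⟫_ℂ =
      ⟪x, (H.inv ^ m * Λ t) y⟫_ℂ) (isClosed_eq (by fun_prop) (by fun_prop)) key x y
  rw [ContinuousLinearMap.isSelfAdjoint_iff_isSymmetric]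
  exact hall

/-- The bounded model of the equation. -/
theorem CommutatorBoundedOn.exists_isBoundedModel {τ : ℝ} {hτ : τ < 1} {I : Set ℝ≥0}
    (h : H.CommutatorBoundedOn m L hτ I) (h0 : 0 ∈ I) (hs : H.SymmetricOnScale m k₀ L)
    {Λ : ℝ → E →L[ℂ] E} (hbc : IsBddCont Λ) (hΛ : IsReduced L Λ) :
    ∃ B, H.IsBoundedModel m (1 - τ).toNNReal Λ B ∧
      ∀ i : ℕ, (2 * i : ℝ≥0) ∈ I → H.BoundedLift B i := by
  obtain ⟨B₀, hcomm, hB₀⟩ := h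
  obtain ⟨B, ⟨-, -⟩, hB⟩ := (hB₀ 0 h0).exists_isBddCont
  have hBB : ∀ t x, B t x = B₀ t x := by
    intro t x
    have h1 := hB t x
    rw [coe_sobEquiv, zero_div, negPow_zero] at h1
    exact h1
  refine ⟨B, ⟨hbc, hs.isSelfAdjoint_of_isReduced hΛ, fun t => ?_⟩, fun i hi => ?_⟩
  · ext y
    -- Testing the form identity with `φ = H⁻¹ u` and `ψ = H^{-(m+1)} y` leaves only bounded
    -- operators.
    refine ext_inner_left ℂ fun u => ?_
    set ψ : H.Sob (2 * m + 2) := H.sobEquiv (2 * m + 2) y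
    have hψ : (ψ : E) = H.negPow (m + 1 : ℕ) y := by
      rw [coe_sobEquiv]
      congr 2
      rw [add_div, mul_div_cancel_left₀ _ two_ne_zero, div_self two_ne_zero]
      push_cast
      rfl
    have hψ1 : (ψ : E) = H.inv ((H.inv ^ m : E →L[ℂ] E) y) := by
      rw [hψ, negPow_natCast, pow_succ']
      rfl
    have hψ2 : (ψ : E) = (H.inv ^ m : E →L[ℂ] E) (H.inv y) := by
      rw [hψ, negPow_natCast, pow_succ]
      rfl
    have hact : ((H.act ψ : H.Sob (2 * m)) : E) = (H.inv ^ m : E →L[ℂ] E) y := by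
      have h1 : (⟨(ψ : E), Sob.mem_domain ψ⟩ : H.toPMap.domain) =
          ⟨H.inv ((H.inv ^ m : E →L[ℂ] E) y), H.inv_mem _⟩ := Subtype.ext hψ1
      exact (congrArg H.toPMap h1).trans (H.apply_inv _)
    have hrp : H.rpow τ ⟨(ψ : E), Sob.mem_rpow_domain hτ.le ψ⟩ =
        (H.inv ^ m : E →L[ℂ] E) (H.negPow (1 - τ).toNNReal y) := by
      have h1 : H.negPow (m + 1 : ℕ) y ∈ (H.rpow τ).domain := by
        rw [← hψ]
        exact Sob.mem_rpow_domain hτ.le ψ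
      have h2 : (⟨(ψ : E), Sob.mem_rpow_domain hτ.le ψ⟩ : (H.rpow τ).domain) =
          ⟨H.negPow (m + 1 : ℕ) y, h1⟩ := Subtype.ext hψ
      rw [h2, H.rpow_apply_negPow (q' := m + (1 - τ).toNNReal), negPow_add, negPow_natCast]
      · rfl
      · rw [NNReal.coe_add, Real.coe_toNNReal _ (by linarith)]
        push_cast
        ring
    have h := hcomm t ⟨H.inv u, H.inv_mem u⟩ ψ
    rw [H.apply_inv, hΛ t y _ hact, hΛ t (H.inv y) (Sob.incl le_self_add ψ) hψ2, hrp, ← hBB] at h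
    have hsa := inner_apply_of_isSelfAdjoint H.inv_isSelfAdjoint
    rw [hsa, hsa, ← inner_sub_right] at h
    exact h
  · obtain ⟨B', ⟨-, C, hC⟩, hB'⟩ := (hB₀ _ hi).exists_isBddCont
    refine ⟨B', C, hC, fun t => ?_⟩
    ext x
    have h1 := hB' t x
    rw [coe_sobEquiv_two_mul, mul_div_cancel_left₀ _ two_ne_zero, negPow_natCast, ← hBB] at h1
    exact h1.symm

theorem IsModelFlow.isPropagator {Λ : ℝ → E →L[ℂ] E} {U V : ℝ → ℝ → E →L[ℂ] E}
    (h : H.IsModelFlow m Λ U V) (hbc : IsBddCont Λ) (hΛ : IsReduced L Λ) :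
    H.IsPropagator m L U := by
  intro s ψs
  obtain ⟨x, rfl⟩ := (H.sobEquiv (2 * m)).surjective ψs
  have hcoe : ∀ t, ((H.sobEquiv (2 * m) (V t s x) : H.Sob (2 * m)) : E) =
      U t s ((H.inv ^ m : E →L[ℂ] E) x) := fun t => by
    rw [coe_sobEquiv_two_mul]
    exact congrArg (fun A : E →L[ℂ] E => A x) (h.intertwine t s)
  have hfun : (fun t => ((H.sobEquiv (2 * m) (V t s x) : H.Sob (2 * m)) : E)) =
      fun t => U t s ((H.inv ^ m : E →L[ℂ] E) x) := funext hcoe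
  refine ⟨fun t => H.sobEquiv (2 * m) (V t s x), fun t => ?_, ?_, ?_, ?_, fun t => ?_⟩
  · rw [hcoe, coe_sobEquiv_two_mul]
  · simp only [h.self_eq_one]
    rfl
  · exact (H.sobEquiv (2 * m)).continuous.comp (h.continuous s x)
  · rw [hfun, contDiff_one_iff_deriv]
    refine ⟨fun t => (h.hasDerivAt t s x).differentiableAt, ?_⟩
    rw [funext fun t => (h.hasDerivAt t s x).deriv]
    exact (hbc.1.clm_apply (h.continuous s x)).const_smul _
  · rw [hfun, (h.hasDerivAt t s x).deriv, hΛ t (V t s x) _ (coe_sobEquiv_two_mul H m _), smul_smul]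
    simp

/-- The difference of two solutions is `w = H^{-m} z`, and `⟪Λ z, H^{-m} z⟫` is real, so `‖w‖` is
constant, hence zero. Agreement on the dense space `𝓗^{2m}` suffices for bounded operators. -/
theorem IsPropagator.eq {Λ : ℝ → E →L[ℂ] E} (hΛ : IsReduced L Λ)
    (hsa : ∀ t, IsSelfAdjoint (H.inv ^ m * Λ t)) {U U' : ℝ → ℝ → E →L[ℂ] E}
    (hU : H.IsPropagator m L U) (hU' : H.IsPropagator m L U') : U = U' := by
  funext t s
  refine ContinuousLinearMap.coeFn_injective ((H.denseRange_inv_pow m).equalizer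
    (U t s).continuous (U' t s).continuous (funext fun x => ?_))
  obtain ⟨ψ, hψ, hψs, -, hψd, hψe⟩ := hU s (H.sobEquiv (2 * m) x)
  obtain ⟨ψ', hψ', hψs', -, hψd', hψe'⟩ := hU' s (H.sobEquiv (2 * m) x)
  set w : ℝ → E := fun r => (ψ r : E) - (ψ' r : E) with hw
  set z : ℝ → E := fun r => (H.sobEquiv (2 * m)).symm (ψ r - ψ' r) with hz
  have hwz : ∀ r, w r = (H.inv ^ m : E →L[ℂ] E) (z r) := fun r => by
    rw [← coe_sobEquiv_two_mul, hz, LinearIsometryEquiv.apply_symm_apply]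
    rfl
  have hder : ∀ {χ : ℝ → H.Sob (2 * m)}, ContDiff ℝ 1 (fun r => (χ r : E)) →
      (∀ r, Complex.I • deriv (fun r => (χ r : E)) r = L r (χ r)) →
      ∀ r, HasDerivAt (fun r => (χ r : E)) (-Complex.I • L r (χ r)) r := by
    intro χ hd he r
    have h1 := ((hd.differentiable one_ne_zero) r).hasDerivAt
    have h2 : -Complex.I • L r (χ r) = deriv (fun r => (χ r : E)) r := by
      rw [← he r, smul_smul]
      simp
    rw [h2]
    exact h1
  have hwd : ∀ r, HasDerivAt w (-Complex.I • Λ r (z r)) r := by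
    intro r
    refine ((hder hψd hψe r).sub (hder hψd' hψe' r)).congr_deriv ?_
    rw [← smul_sub, ← map_sub, hΛ r (z r) (ψ r - ψ' r) (hwz r)]
  have hn : ∀ r, HasDerivAt (fun r => ‖w r‖ ^ 2) 0 r := by
    intro r
    refine (hasDerivAt_norm_sq_complex (hwd r)).congr_deriv ?_
    have h1 := re_inner_neg_I_smul_apply (hsa r) (z r)
    have h2 : ⟪-Complex.I • Λ r (z r), w r⟫_ℂ =
        ⟪-Complex.I • (H.inv ^ m * Λ r) (z r), z r⟫_ℂ := by
      rw [hwz, ← inner_apply_of_isSelfAdjoint (H.inv_isSelfAdjoint.pow m), map_smul]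
      rfl
    rw [h2, h1, mul_zero]
  have hconst := is_const_of_deriv_eq_zero (fun r => (hn r).differentiableAt)
    (fun r => (hn r).deriv) t s
  have hws : w s = 0 := by simp only [hw, hψs, hψs', sub_self]
  rw [hws, norm_zero, zero_pow two_ne_zero] at hconst
  have hwt : w t = 0 := norm_eq_zero.mp (pow_eq_zero_iff two_ne_zero |>.mp hconst)
  have h1 := hψ t
  have h2 := hψ' t
  rw [coe_sobEquiv_two_mul] at h1 h2
  change U t s _ = U' t s _
  rw [← h1, ← h2]
  exact sub_eq_zero.mp hwt

/-- Here `Z = H^k U H^{-k}`, and `H^{-k}` is an isometry of `𝓗^0` onto `𝓗^{2k}`. -/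
theorem normBound_of_mul_negPow_eq {k : ℝ≥0} {U Z : E →L[ℂ] E} {M : ℝ} (hZ : ‖Z‖ ≤ M)
    (h : U * H.negPow k = H.negPow k * Z) : H.NormBound (2 * k) U M := by
  intro ψ
  obtain ⟨x, rfl⟩ := (H.sobEquiv (2 * k)).surjective ψ
  refine ⟨H.sobEquiv (2 * k) (Z x), ?_, ?_⟩
  · rw [coe_sobEquiv, coe_sobEquiv, mul_div_cancel_left₀ _ two_ne_zero]
    exact (congrArg (fun A : E →L[ℂ] E => A x) h).symm
  · rw [LinearIsometryEquiv.norm_map, LinearIsometryEquiv.norm_map]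
    exact (Z.le_opNorm x).trans (mul_le_mul_of_nonneg_right hZ (norm_nonneg _))

namespace IsBoundedModel

variable {δ : ℝ≥0} {Λ B : ℝ → E →L[ℂ] E} (hM : H.IsBoundedModel m δ Λ B)

include hM

theorem existsUnique_isPropagator (hΛ : IsReduced L Λ) (hδ : 0 < δ)
    (hB : ∀ i < m + 1, H.BoundedLift B i) : ∃! U, H.IsPropagator m L U := by
  -- Existence needs no growth bound, so `K = 0` and `θ = 1` are harmless.
  obtain ⟨U, V, h, -⟩ := hM.exists_isModelFlow hδ hB 0 (by simp) one_pos le_rfl (by simp)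
  have hU := h.isPropagator hM.bddCont hΛ
  exact ⟨U, hU, fun U' hU' => hU'.eq hΛ hM.isSelfAdjoint hU⟩

/-- Polynomial growth of the propagator in the norm of `𝓗^{2ηK}`. -/
theorem exists_normBound (hΛ : IsReduced L Λ) (hδ : 0 < δ)
    (hB : ∀ i < m + 1, H.BoundedLift B i) {K : ℕ} (hK : ∀ i < K, H.BoundedLift B i)
    {θ η : ℝ≥0} (hθ : 0 < θ) (hθ1 : θ ≤ 1) (hθK : θ * K ≤ δ) (hη : η ≤ 1) {e : ℝ}
    (he : (η : ℝ) / θ ≤ e) {U : ℝ → ℝ → E →L[ℂ] E} (hU : H.IsPropagator m L U) :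
    ∃ C : ℝ, 0 < C ∧ ∀ t s,
      H.NormBound (2 * (η * K)) (U t s) (C * japaneseBracket (t - s) ^ e) := by
  obtain ⟨U', V, h, C, hC0, hC⟩ := hM.exists_isModelFlow hδ hB K hK hθ hθ1 hθK
  obtain rfl := hU.eq hΛ hM.isSelfAdjoint (h.isPropagator hM.bddCont hΛ)
  refine ⟨C ^ ((η : ℝ) / θ), by positivity, fun t s => ?_⟩
  have hj := one_le_japaneseBracket (t - s)
  obtain ⟨Z, hZ, hUZ⟩ := h.exists_mul_negPow_eq (by positivity) (hC t s) hη
  refine normBound_of_mul_negPow_eq (hZ.trans ?_) hUZ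
  rw [← Real.rpow_mul (by positivity), one_div_mul_eq_div, Real.mul_rpow hC0.le (by positivity)]
  gcongr

end IsBoundedModel

end PositiveOperator

/-! ### The theorem: choice of `K`, `θ` and `η`. -/

theorem theorem1p2 {E : Type*} [NormedAddCommGroup E] [InnerProductSpace ℂ E] [CompleteSpace E]
    (H : PositiveOperator E) (m k₀ : ℕ) (hk₀ : 2 * m < k₀)
    (L : ℝ → H.Sob (2 * m) →ₗ[ℂ] E)
    (hL : H.BoundedOnScale m k₀ L) (hsymm : H.SymmetricOnScale m k₀ L)
    (τ : ℝ) (hτ : τ < 1) :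
    (∀ k₁ : ℝ, 2 * (m : ℝ) < k₁ →
      H.CommutatorBoundedOn m L hτ {k : ℝ≥0 | (k : ℝ) ≤ 2 * k₁} →
      (∃! U : ℝ → ℝ → E →L[ℂ] E, H.IsPropagator m L U) ∧
      ∀ U : ℝ → ℝ → E →L[ℂ] E, H.IsPropagator m L U →
        ∀ k : ℝ≥0, (k : ℝ) ≤ min (k₀ : ℝ) (2 * k₁) - 4 * m → (k : ℝ) ≤ k₁ →
        ∀ p : ℕ, (k : ℝ) / (1 - τ) ≤ p →
          ∃ C : ℝ, 0 < C ∧ ∀ t s : ℝ,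
            H.NormBound (2 * k) (U t s) (C * japaneseBracket (t - s) ^ p)) ∧
    (H.CommutatorBoundedOn m L hτ (Set.range ((↑) : ℕ → ℝ≥0)) → (∃ q : ℚ, (q : ℝ) = τ) →
      (∃! U : ℝ → ℝ → E →L[ℂ] E, H.IsPropagator m L U) ∧
      ∀ U : ℝ → ℝ → E →L[ℂ] E, H.IsPropagator m L U →
        ∀ r : ℝ≥0, 0 < r →
          ∃ C : ℝ, 0 < C ∧ ∀ t s : ℝ,
            H.NormBound r (U t s)
              (C * japaneseBracket (t - s) ^ ((r : ℝ) / (2 * (1 - τ))))) := by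
  obtain ⟨Λ, hbc, hΛ⟩ := hL.exists_isReduced
  have hδ' : 0 < 1 - τ := sub_pos.mpr hτ
  have hδ : 0 < (1 - τ).toNNReal := Real.toNNReal_pos.mpr hδ'
  have hδc : ((1 - τ).toNNReal : ℝ) = 1 - τ := Real.coe_toNNReal _ hδ'.le
  refine ⟨fun k₁ hk₁ hcomm => ?_, fun hcomm _ => ?_⟩
  · obtain ⟨B, hM, hlift⟩ := hcomm.exists_isBoundedModel (show ((0 : ℝ≥0) : ℝ) ≤ 2 * k₁ by
      have : (0 : ℝ) ≤ 2 * m := by positivity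
      rw [NNReal.coe_zero]
      linarith) hsymm hbc hΛ
    have hlift' : ∀ i : ℕ, (i : ℝ) ≤ k₁ → H.BoundedLift B i := fun i hi => hlift i (by
      change ((2 * i : ℝ≥0) : ℝ) ≤ 2 * k₁
      push_cast
      linarith)
    have hB : ∀ i < m + 1, H.BoundedLift B i := fun i hi => hlift' i (by
      have h1 : (i : ℝ) ≤ m := by exact_mod_cast Nat.lt_succ_iff.mp hi
      have h2 : (0 : ℝ) ≤ m := by positivity
      linarith)
    refine ⟨hM.existsUnique_isPropagator hΛ hδ hB, fun U hU k _ hk p hp => ?_⟩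
    simp only [← Real.rpow_natCast]
    rcases eq_or_ne k 0 with rfl | hk0
    · have h := hM.exists_normBound hΛ hδ hB (K := 0) (by simp) (θ := 1) (η := 0) one_pos le_rfl
        (by simp) zero_le_one (e := p) (by simp) hU
      simpa using h
    · have hkpos : 0 < k := pos_iff_ne_zero.mpr hk0
      have hK0 : 0 < ⌈k⌉₊ := Nat.ceil_pos.mpr hkpos
      have hkK : k ≤ ⌈k⌉₊ := Nat.le_ceil k
      have hKp : (0 : ℝ≥0) < ⌈k⌉₊ := by exact_mod_cast hK0
      have hkeq : k / ⌈k⌉₊ * ⌈k⌉₊ = k := div_mul_cancel₀ _ hKp.ne'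
      -- With `K = ⌈k⌉` only lifts with `i < k ≤ k₁` are required. The minimum with `1` keeps `θ`
      -- admissible when `δ > K`.
      have h := hM.exists_normBound hΛ hδ hB (K := ⌈k⌉₊) (fun i hi => hlift' i (by
          have h1 : (i : ℝ≥0) < k := Nat.lt_ceil.mp hi
          have h2 : (i : ℝ) < k := by exact_mod_cast h1
          linarith))
        (θ := min 1 ((1 - τ).toNNReal / ⌈k⌉₊)) (η := k / ⌈k⌉₊)
        (lt_min one_pos (div_pos hδ hKp)) (min_le_left _ _)
        ((mul_le_mul_of_nonneg_right (min_le_right _ _) hKp.le).trans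
          (div_mul_cancel₀ _ hKp.ne').le)
        (div_le_one_of_le₀ hkK hKp.le) (e := p) (by
          have hkr : (0 : ℝ) < k := hkpos
          have hKr : (0 : ℝ) < ⌈k⌉₊ := by exact_mod_cast hK0
          -- Integrality of `p` enters here: if `θ = 1` the exponent is `k / K ≤ 1`, possibly larger
          -- than `k / δ`, but a positive integer `p` still dominates it.
          have hp1 : (1 : ℝ) ≤ p := by
            have : (0 : ℝ) < p := lt_of_lt_of_le (div_pos hkr hδ') hp
            exact_mod_cast Nat.succ_le_of_lt (Nat.cast_pos.mp this)
          rw [div_le_iff₀ (by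
            rw [NNReal.coe_pos]
            exact lt_min one_pos (div_pos hδ hKp))]
          push_cast
          rw [hδc]
          rcases min_cases (1 : ℝ) ((1 - τ) / ⌈k⌉₊) with ⟨h1, -⟩ | ⟨h1, -⟩
          · rw [h1, mul_one]
            refine le_trans ?_ hp1
            rw [div_le_one hKr]
            exact_mod_cast hkK
          · rw [h1, ← mul_div_assoc]
            gcongr
            rwa [div_le_iff₀ hδ'] at hp) hU
      rwa [hkeq] at h
  · obtain ⟨B, hM, hlift⟩ := hcomm.exists_isBoundedModel ⟨0, Nat.cast_zero⟩ hsymm hbc hΛ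
    have hlift' : ∀ i : ℕ, H.BoundedLift B i := fun i => hlift i ⟨2 * i, by push_cast; rfl⟩
    refine ⟨hM.existsUnique_isPropagator hΛ hδ fun i _ => hlift' i, fun U hU r hr => ?_⟩
    -- All lifts are available, so `K` can be taken at least `δ`. Then `θ = δ / K` needs no
    -- truncation and the exponent is exactly `(r/2) / δ`.
    set K := ⌈max (r / 2) (1 - τ).toNNReal⌉₊ with hK
    have hle : max (r / 2) (1 - τ).toNNReal ≤ K := Nat.le_ceil _
    have hKp : (0 : ℝ≥0) < K := lt_of_lt_of_le hδ ((le_max_right _ _).trans hle)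
    have h := hM.exists_normBound hΛ hδ (fun i _ => hlift' i) (K := K) (fun i _ => hlift' i)
      (θ := (1 - τ).toNNReal / K) (η := r / 2 / K) (div_pos hδ hKp)
      (div_le_one_of_le₀ ((le_max_right _ _).trans hle) hKp.le)
      (div_mul_cancel₀ _ hKp.ne').le
      (div_le_one_of_le₀ ((le_max_left _ _).trans hle) hKp.le)
      (e := (r : ℝ) / (2 * (1 - τ))) (by
        have hKr : (0 : ℝ) < K := by exact_mod_cast hKp
        push_cast
        rw [hδc, div_div_div_cancel_right₀ hKr.ne', div_div]) hU
    have hreq : 2 * (r / 2 / K * K) = r := by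
      rw [div_mul_cancel₀ _ hKp.ne', mul_div_cancel₀ _ two_ne_zero]
    rwa [hreq] at h
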